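/- **Setting.** Let $q_0>0$, let $\sigma,x,t\in\mathbb R$, and let $\mathbf q_\pm\in\mathbb C^2$ satisfy $\|\mathbf q_\pm\|=q_0$ and $\mathbf q_+^\dagger\mathbf q_-\neq0$. For $\mathbf v=(v_1,v_2)^T$ put $\mathbf v^\perp=(\bar v_2,-\bar v_1)^T$. Put $k=\frac12(z+q_0^2/z)$, $\lambda=\frac12(z-q_0^2/z)$, $\widehat\rho(z)=z^2/(z^2-q_0^2)$, $$\delta_1=\lambda x+2\lambda[k+\sigma(3k^2-\lambda^2)]t,\qquad \delta_2=-kx-(\lambda^2+k^2+4\sigma k^3)t,\qquad \mathbf\Delta=\operatorname{diag}(\delta_1,\delta_2,-\delta_1).$$ Let $\mathbb D^\pm=\{z\in\mathbb C:\pm\operatorname{Im}z>0\}$. **Data.** Let $\beta_1,\beta_2:\mathbb R\to\mathbb C$ be functions and write $\widehat\beta_j(z)=\beta_j(q_0^2/z)$. For $z\in\mathbb R\setminus\{0,\pm q_0\}$ let $$\mathbf K=\begin{pmatrix} \mathrm i\widehat\rho(1+\beta_1^*\widehat\beta_1^*)-\mathrm i|\beta_2|^2+\frac{z}{q_0}\beta_1^*\beta_2^*\widehat\beta_2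 & \frac{z}{q_0}\widehat\beta_1^*\widehat\beta_2^*-\mathrm i\beta_2^*-\frac{\mathrm iz^2}{q_0^2\widehat\rho}\beta_2^*|\widehat\beta_2|^2 & \frac{\mathrm iz}{q_0\widehat\rho}\widehat\beta_2\beta_2^*-\widehat\beta_1^*\\ \beta_2+\frac{\mathrm iz}{q_0}\beta_1^*\widehat\beta_2 & 1+\frac{z^2}{q_0^2\widehat\rho}|\widehat\beta_2|^2 & -\frac{z}{q_0\widehat\rho}\widehat\beta_2\\ -\beta_1^* & \frac{\mathrm iz}{q_0\widehat\rho}\widehat\beta_2^* & \frac1{\mathrm i\widehat\rho} \end{pmatrix},\qquad \mathbf L=\mathbf K-\mathbf I .$$ Let $z_1,\dots,z_{M_1}\in\mathbb D^+$ be distinct with $|z_m|=q_0$ and $\theta_1,\dots,\theta_{M_2}\in\mathbb D^+$ distinct with $|\theta_m|<q_0$ ($M_1,M_2\ge0$). With arbitrary complex constants carrying the superscript $0$, let $$C_m=C_m^0\mathrm e^{-2\mathrm i\delta_1(z_m)},\quad \bar C_m=\bar C_m^0\mathrm e^{2\mathrm i\delta_1(z_m^*)},\quad F_m=F_m^0\mathrm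 e^{\mathrm i[\delta_2-\delta_1](\theta_m)},\quad \check F_m=\check F_m^0\mathrm e^{\mathrm i[\delta_2-\delta_1](\theta_m)},$$ $$\bar F_m=\bar F_m^0\mathrm e^{\mathrm i[\delta_1-\delta_2](\theta_m^*)},\quad \hat F_m=\hat F_m^0\mathrm e^{\mathrm i[\delta_1-\delta_2](\theta_m^*)}.$$ Let $$\mathbf R_\infty^+=\begin{pmatrix}\mathrm i&0&0\\ \mathbf 0&\frac{q_0\mathbf q_+^\perp}{\mathbf q_+^\dagger\mathbf q_-}&\frac{\mathbf q_-}{\mathrm iq_0}\end{pmatrix},\quad \mathbf R_\infty^-=\begin{pmatrix}1&0&0\\ \mathbf 0&\frac{\mathbf q_-^\perp}{q_0}&\frac{q_0\mathbf q_+}{\mathbf q_-^\dagger\mathbf q_+}\end{pmatrix},\quad \mathbf R_0^+=\begin{pmatrix}0&0&-\mathrm iq_0\\ \mathbf 0&\mathbf 0&\mathbf 0\end{pmatrix},\quad \mathbf R_0^-=\begin{pmatrix}0&0&0\\ \mathbf q_-&\mathbf 0&\mathbf 0\end{pmatrix}.$$ **The RH problem.** A solution is a pair of $3\times3$ matrix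 functions $\mathbf R^\pm=(\mathbf R_1^\pm,\mathbf R_2^\pm,\mathbf R_3^\pm)$ such that: 1. $\mathbf R^\pm$ is meromorphic in $\mathbb D^\pm$ and analytic except for at most simple poles of $\mathbf R_1^+$ at $z_m,\theta_m$, of $\mathbf R_2^+$ at $q_0^2/\theta_m^*$, of $\mathbf R_2^-$ at $\theta_m^*$, and of $\mathbf R_3^-$ at $z_m^*,q_0^2/\theta_m$. It extends continuously to $\mathbb R\setminus\{0,\pm q_0\}$ and is bounded near $\pm q_0$. 2. $\mathbf R^+=\mathbf R^-\mathrm e^{\mathrm i\mathbf\Delta}\mathbf K\mathrm e^{-\mathrm i\mathbf\Delta}$ on $\mathbb R\setminus\{0,\pm q_0\}$. 3. In $\mathbb D^\pm$, $\mathbf R^\pm=\mathbf R_\infty^\pm+O(1/z)$ as $z\to\infty$ and $\mathbf R^\pm=\frac1z\mathbf R_0^\pm+O(1)$ as $z\to0$. 4. The residues are (all columns not displayed vanish) $$\operatorname*{Res}_{z_m}\mathbf R^+=[\mathrm iC_m\widehat\rho(z_m)\mathbf R_3^+(z_m),\mathbf 0,\mathbf 0],\qquad \operatorname*{Res}_{z_m^*}\mathbf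 R^-=[\mathbf 0,\mathbf 0,\mathrm i\bar C_m\widehat\rho(z_m^*)\mathbf R_1^-(z_m^*)],$$ $$\operatorname*{Res}_{\theta_m}\mathbf R^+=[-F_m\mathbf R_2^+(\theta_m),\mathbf 0,\mathbf 0],\qquad \operatorname*{Res}_{\theta_m^*}\mathbf R^-=[\mathbf 0,\mathrm i\bar F_m\widehat\rho(\theta_m^*)\mathbf R_1^-(\theta_m^*),\mathbf 0],$$ $$\operatorname*{Res}_{q_0^2/\theta_m}\mathbf R^-=[\mathbf 0,\mathbf 0,\check F_m\mathbf R_2^-(q_0^2/\theta_m)],\qquad \operatorname*{Res}_{q_0^2/\theta_m^*}\mathbf R^+=[\mathbf 0,-\mathrm i\hat F_m\widehat\rho(q_0^2/\theta_m^*)\mathbf R_3^+(q_0^2/\theta_m^*),\mathbf 0].$$ **Theorem.** Let $(\mathbf R^+,\mathbf R^-)$ be a solution. Write $\mathbf R(z)=\mathbf R^\pm(z)$, $\mathbf R_\infty(z)=\mathbf R_\infty^\pm$, $\mathbf R_0(z)=\mathbf R_0^\pm$ for $z\in\mathbb D^\pm$, $\mathbf R_\infty^\nabla=\mathbf R_\infty^--\mathbf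 R_\infty^+$, $\mathbf R_0^\nabla=\mathbf R_0^--\mathbf R_0^+$ and $$\mathbf A(\zeta)=\mathbf R_\infty^\nabla+\tfrac1\zeta\mathbf R_0^\nabla+\mathbf R^-(\zeta)\mathrm e^{\mathrm i\mathbf\Delta(\zeta)}\mathbf L(\zeta)\mathrm e^{-\mathrm i\mathbf\Delta(\zeta)},\qquad \mathcal C(z)=\frac1{2\pi\mathrm i}\int_{\mathbb R}\frac{\mathbf A(\zeta)}{\zeta-z}\,\mathrm d\zeta ,$$ and let $\mathcal C_j$ be the $j$-th column of $\mathcal C$. The integral converges absolutely for every $z\notin\mathbb R$. For every $z\notin\mathbb R$ other than the points $z_m,z_m^*,\theta_m,\theta_m^*,q_0^2/\theta_m,q_0^2/\theta_m^*$, $$\begin{aligned}\mathbf R(z)&=\mathbf R_\infty(z)+\frac1z\mathbf R_0(z)+\mathcal C(z) +\sum_{m=1}^{M_1}\Big[\frac{\operatorname{Res}_{z_m}\mathbf R^+}{z-z_m}+\frac{\operatorname{Res}_{z_m^*}\mathbf R^-}{z-z_m^*}\Big] +\sum_{m=1}^{M_2}\Big[\frac{\operatorname{Res}_{\theta_m}\mathbf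 R^+}{z-\theta_m}+\frac{\operatorname{Res}_{\theta_m^*}\mathbf R^-}{z-\theta_m^*}\Big]\\ &\quad+\sum_{m=1}^{M_2}\Big[\frac{\operatorname{Res}_{q_0^2/\theta_m^*}\mathbf R^+}{z-q_0^2/\theta_m^*}+\frac{\operatorname{Res}_{q_0^2/\theta_m}\mathbf R^-}{z-q_0^2/\theta_m}\Big].\end{aligned}$$ Further, for all $z\in\mathbb D^-$ (in particular $z=\theta_n^*,z_n^*$), $$\mathbf R_1^-(z)=\begin{pmatrix}1\\ \mathbf q_- /z\end{pmatrix}+\mathcal C_1(z)+\sum_{m=1}^{M_1}\frac{\mathrm iC_m\widehat\rho(z_m)\mathbf R_3^+(z_m)}{z-z_m}-\sum_{m=1}^{M_2}\frac{F_m\mathbf R_2^+(\theta_m)}{z-\theta_m};$$ for all $z\in\mathbb D^+$ (in particular $z=z_n,q_0^2/\theta_n^*$), $$\mathbf R_3^+(z)=\begin{pmatrix}-\mathrm iq_0/z\\ -\mathrm i\mathbf q_- /q_0\end{pmatrix}+\mathcal C_3(z)+\sum_{m=1}^{M_1}\frac{\mathrm i\bar C_m\widehat\rho(z_m^*)\mathbf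 R_1^-(z_m^*)}{z-z_m^*}+\sum_{m=1}^{M_2}\frac{\check F_m\mathbf R_2^-(q_0^2/\theta_m)}{z-q_0^2/\theta_m};$$ and for $n=1,\dots,M_2$, with $w_n=q_0^2/\theta_n$, $$\mathbf R_2^+(\theta_n)=\begin{pmatrix}0\\ q_0\mathbf q_+^\perp/\mathbf q_+^\dagger\mathbf q_-\end{pmatrix}+\mathcal C_2(\theta_n)+\sum_{m=1}^{M_2}\frac{\mathrm i\bar F_m\widehat\rho(\theta_m^*)\mathbf R_1^-(\theta_m^*)}{\theta_n-\theta_m^*}-\sum_{m=1}^{M_2}\frac{\mathrm i\hat F_m\widehat\rho(q_0^2/\theta_m^*)\mathbf R_3^+(q_0^2/\theta_m^*)}{\theta_n-q_0^2/\theta_m^*},$$ $$\mathbf R_2^-(w_n)=\begin{pmatrix}0\\ \mathbf q_-^\perp/q_0\end{pmatrix}+\mathcal C_2(w_n)+\sum_{m=1}^{M_2}\frac{\mathrm i\bar F_m\widehat\rho(\theta_m^*)\mathbf R_1^-(\theta_m^*)}{w_n-\theta_m^*}-\sum_{m=1}^{M_2}\frac{\mathrm i\hat F_m\widehat\rho(q_0^2/\theta_m^*)\mathbf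 R_3^+(q_0^2/\theta_m^*)}{w_n-q_0^2/\theta_m^*}.$$ -/

import Mathlib

open Complex Filter Topology MeasureTheory Asymptotics

noncomputable section

namespace HirotaRH

/-- `3 × 3` complex matrices. -/
abbrev Mat3 : Type := Matrix (Fin 3) (Fin 3) ℂ

/-- Two-component complex vectors with the Hermitian norm;
`inner ℂ v w` is `v† w`, conjugate linear in `v`. -/
abbrev Vec2 : Type := EuclideanSpace ℂ (Fin 2)

/-- The open upper half-plane. -/
def DPlus : Set ℂ := {z | 0 < z.im}

/-- The open lower half-plane. -/
def DMinus : Set ℂ := {z | z.im < 0}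

/-- The closed upper half-plane. -/
def DPlusClosed : Set ℂ := {z | 0 ≤ z.im}

/-- The closed lower half-plane. -/
def DMinusClosed : Set ℂ := {z | z.im ≤ 0}

/-- `v^⊥ = (v₂, -v₁)†`. -/
def perp (v : Vec2) : Vec2 :=
  WithLp.toLp 2 ![(starRingEnd ℂ) (v 1), -(starRingEnd ℂ) (v 0)]

/-! ### Uniformization variable and phases -/

/-- `k(z) = (z + q₀²/z)/2`. -/
def kfun (q₀ : ℝ) (z : ℂ) : ℂ := (z + (q₀ : ℂ) ^ 2 / z) / 2

/-- `λ(z) = (z - q₀²/z)/2`. -/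
def lam (q₀ : ℝ) (z : ℂ) : ℂ := (z - (q₀ : ℂ) ^ 2 / z) / 2

/-- `ρ̂(z) = z²/(z² - q₀²)`. -/
def rho (q₀ : ℝ) (z : ℂ) : ℂ := z ^ 2 / (z ^ 2 - (q₀ : ℂ) ^ 2)

/-- `δ₁(z; x, t) = λ x + 2 λ [k + σ (3 k² - λ²)] t`. -/
def delta₁ (q₀ σ x t : ℝ) (z : ℂ) : ℂ :=
  lam q₀ z * x
    + 2 * lam q₀ z * (kfun q₀ z + σ * (3 * kfun q₀ z ^ 2 - lam q₀ z ^ 2)) * t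

/-- `δ₂(z; x, t) = -k x - (λ² + k² + 4 σ k³) t`. -/
def delta₂ (q₀ σ x t : ℝ) (z : ℂ) : ℂ :=
  -(kfun q₀ z) * x
    - (lam q₀ z ^ 2 + kfun q₀ z ^ 2 + 4 * σ * kfun q₀ z ^ 3) * t

/-- The diagonal of `Δ = diag(δ₁, δ₂, -δ₁)`. -/
def Delta (q₀ σ x t : ℝ) (z : ℂ) : Fin 3 → ℂ :=
  ![delta₁ q₀ σ x t z, delta₂ q₀ σ x t z, -delta₁ q₀ σ x t z]

/-- The matrix `exp(i Δ(z))`. -/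
def expDelta (q₀ σ x t : ℝ) (z : ℂ) : Mat3 :=
  Matrix.diagonal fun j => exp (I * Delta q₀ σ x t z j)

/-- The matrix `exp(-i Δ(z))`. -/
def expNegDelta (q₀ σ x t : ℝ) (z : ℂ) : Mat3 :=
  Matrix.diagonal fun j => exp (-(I * Delta q₀ σ x t z j))

/-! ### Spectral data -/

/-- The data of the Riemann-Hilbert problem: reflection coefficients `β₁, β₂` on the real line,
discrete eigenvalues `z_m` on the circle of radius `q₀` and `θ_m` inside it, in the upper
half-plane (with their mirror images under `z ↦ z*` and `z ↦ q₀²/z`), and the `(x,t)`-independent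
factors of the norming constants, e.g. `C⁰_m = c_m / h₁₁'(z_m)`. No symmetry between the norming
constants is imposed. -/
structure SpectralData (q₀ : ℝ) (M₁ M₂ : ℕ) where
  β₁ : ℝ → ℂ
  β₂ : ℝ → ℂ
  z : Fin M₁ → ℂ
  θ : Fin M₂ → ℂ
  z_im_pos : ∀ m, 0 < (z m).im
  z_norm : ∀ m, ‖z m‖ = q₀
  z_injective : Function.Injective z
  θ_im_pos : ∀ m, 0 < (θ m).im
  θ_norm_lt : ∀ m, ‖θ m‖ < q₀
  θ_injective : Function.Injective θ
  C₀ : Fin M₁ → ℂ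
  Cbar₀ : Fin M₁ → ℂ
  F₀ : Fin M₂ → ℂ
  Fbar₀ : Fin M₂ → ℂ
  Fcheck₀ : Fin M₂ → ℂ
  Fhat₀ : Fin M₂ → ℂ

namespace SpectralData

variable {q₀ : ℝ} {M₁ M₂ : ℕ} (d : SpectralData q₀ M₁ M₂)

/-- `z_m*`. -/
def zc (m : Fin M₁) : ℂ := (starRingEnd ℂ) (d.z m)

/-- `θ_m*`. -/
def θc (m : Fin M₂) : ℂ := (starRingEnd ℂ) (d.θ m)

/-- `q₀²/θ_m`. -/
def θi (m : Fin M₂) : ℂ := (q₀ : ℂ) ^ 2 / d.θ m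

/-- `q₀²/θ_m*`. -/
def θic (m : Fin M₂) : ℂ := (q₀ : ℂ) ^ 2 / (starRingEnd ℂ) (d.θ m)

/-- `C_m`. -/
def C (σ x t : ℝ) (m : Fin M₁) : ℂ :=
  d.C₀ m * exp (-2 * I * delta₁ q₀ σ x t (d.z m))

/-- `C̄_m`. -/
def Cbar (σ x t : ℝ) (m : Fin M₁) : ℂ :=
  d.Cbar₀ m * exp (2 * I * delta₁ q₀ σ x t (d.zc m))

/-- `F_m`. -/
def F (σ x t : ℝ) (m : Fin M₂) : ℂ :=
  d.F₀ m * exp (I * (delta₂ q₀ σ x t (d.θ m) - delta₁ q₀ σ x t (d.θ m)))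

/-- `F̄_m`. -/
def Fbar (σ x t : ℝ) (m : Fin M₂) : ℂ :=
  d.Fbar₀ m * exp (I * (delta₁ q₀ σ x t (d.θc m) - delta₂ q₀ σ x t (d.θc m)))

/-- `F̌_m`. -/
def Fcheck (σ x t : ℝ) (m : Fin M₂) : ℂ :=
  d.Fcheck₀ m * exp (I * (delta₂ q₀ σ x t (d.θ m) - delta₁ q₀ σ x t (d.θ m)))

/-- `F̂_m`. -/
def Fhat (σ x t : ℝ) (m : Fin M₂) : ℂ :=
  d.Fhat₀ m * exp (I * (delta₁ q₀ σ x t (d.θc m) - delta₂ q₀ σ x t (d.θc m)))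

/-- The whole discrete spectrum. -/
def spectrum : Set ℂ :=
  Set.range d.z ∪ Set.range d.zc ∪ Set.range d.θ ∪ Set.range d.θc
    ∪ Set.range d.θi ∪ Set.range d.θic

/-- Poles of the `j`-th column of `R⁺`: `z_m, θ_m` for the first, `q₀²/θ_m*` for the second. -/
def polesPlus : Fin 3 → Set ℂ :=
  ![Set.range d.z ∪ Set.range d.θ, Set.range d.θic, ∅]

/-- Poles of the `j`-th column of `R⁻`: `θ_m*` for the second, `z_m*, q₀²/θ_m` for the third. -/
def polesMinus : Fin 3 → Set ℂ :=
  ![∅, Set.range d.θc, Set.range d.zc ∪ Set.range d.θi]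

/-- The matrix `K(z)`, `z` real, that defines the jump; `b̂(z) = b(q₀²/z)`. -/
def K (s : ℝ) : Mat3 :=
  let z : ℂ := s
  let q : ℂ := q₀
  let ρ : ℂ := rho q₀ z
  let b₁ : ℂ := d.β₁ s
  let b₂ : ℂ := d.β₂ s
  let h₁ : ℂ := d.β₁ (q₀ ^ 2 / s)
  let h₂ : ℂ := d.β₂ (q₀ ^ 2 / s)
  let b₁c : ℂ := (starRingEnd ℂ) b₁
  let b₂c : ℂ := (starRingEnd ℂ) b₂
  let h₁c : ℂ := (starRingEnd ℂ) h₁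
  let h₂c : ℂ := (starRingEnd ℂ) h₂
  !![I * ρ * (1 + b₁c * h₁c) - I * (b₂ * b₂c) + z * b₁c * b₂c * h₂ / q,
      z * h₁c * h₂c / q - I * b₂c - I * z ^ 2 * b₂c * (h₂ * h₂c) / (q ^ 2 * ρ),
      I * z * h₂ * b₂c / (q * ρ) - h₁c;
    b₂ + I * z / q * b₁c * h₂,
      1 + z ^ 2 / (q ^ 2 * ρ) * (h₂ * h₂c),
      -(z / (q * ρ) * h₂);
    -b₁c,
      I * z / (q * ρ) * h₂c,
      1 / (I * ρ)]

/-- `L = K - I`. -/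
def L (s : ℝ) : Mat3 := d.K s - 1

end SpectralData

/-! ### Leading coefficients at infinity and at the origin -/

/-- `R_∞⁺`. -/
def RinfPlus (q₀ : ℝ) (qp qm : Vec2) : Mat3 :=
  !![I, 0, 0;
    0, q₀ * perp qp 0 / inner ℂ qp qm, qm 0 / (I * q₀);
    0, q₀ * perp qp 1 / inner ℂ qp qm, qm 1 / (I * q₀)]

/-- `R_∞⁻`. -/
def RinfMinus (q₀ : ℝ) (qp qm : Vec2) : Mat3 :=
  !![1, 0, 0;
    0, perp qm 0 / q₀, q₀ * qp 0 / inner ℂ qm qp;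
    0, perp qm 1 / q₀, q₀ * qp 1 / inner ℂ qm qp]

/-- `R₀⁺`. -/
def RzeroPlus (q₀ : ℝ) : Mat3 :=
  !![0, 0, -I * q₀;
    0, 0, 0;
    0, 0, 0]

/-- `R₀⁻`. -/
def RzeroMinus (qm : Vec2) : Mat3 :=
  !![0, 0, 0;
    qm 0, 0, 0;
    qm 1, 0, 0]

/-! ### Residues -/

/-- `f` is meromorphic at `p` with at most a simple pole there. -/
def AtMostSimplePole (f : ℂ → ℂ) (p : ℂ) : Prop :=
  MeromorphicAt f p ∧ -1 ≤ meromorphicOrderAt f p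

/-- The residue at `p` of a function with at most a simple pole at `p`: the limit of
`(z - p) f(z)`. It is only used where `AtMostSimplePole f p` holds. -/
def residue (f : ℂ → ℂ) (p : ℂ) : ℂ :=
  limUnder (𝓝[≠] p) fun z => (z - p) * f z

/-- Entrywise residue of a matrix function. -/
def matResidue (R : ℂ → Mat3) (p : ℂ) : Mat3 :=
  Matrix.of fun i j => residue (fun z => R z i j) p

/-! ### The Riemann-Hilbert problem -/

/-- `(R⁺, R⁻)`, given on the closed upper and lower half-planes (with boundary values on the real
line), solves the Riemann-Hilbert problem at `(x,t)`. In the residue conditions only those columns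
of `R^±(p)` that are analytic at `p` are multiplied by a nonzero entry. -/
structure IsRHSolution {q₀ : ℝ} {M₁ M₂ : ℕ} (σ x t : ℝ) (qp qm : Vec2)
    (d : SpectralData q₀ M₁ M₂) (Rp Rm : ℂ → Mat3) : Prop where
  /-- Each column is analytic in the open half-plane off its poles. -/
  analytic_plus : ∀ i j, DifferentiableOn ℂ (fun z => Rp z i j) (DPlus \ d.polesPlus j)
  analytic_minus : ∀ i j, DifferentiableOn ℂ (fun z => Rm z i j) (DMinus \ d.polesMinus j)
  /-- The poles are at most simple. -/
  simple_plus : ∀ i j, ∀ p ∈ d.polesPlus j, AtMostSimplePole (fun z => Rp z i j) p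
  simple_minus : ∀ i j, ∀ p ∈ d.polesMinus j, AtMostSimplePole (fun z => Rm z i j) p
  /-- Continuous boundary values on the real line off `0, ±q₀`. -/
  boundary_plus : ∀ i j, ContinuousOn (fun z => Rp z i j)
    (DPlusClosed \ (d.polesPlus j ∪ {0, (q₀ : ℂ), -(q₀ : ℂ)}))
  boundary_minus : ∀ i j, ContinuousOn (fun z => Rm z i j)
    (DMinusClosed \ (d.polesMinus j ∪ {0, (q₀ : ℂ), -(q₀ : ℂ)}))
  /-- The jump condition. -/
  jump : ∀ s : ℝ, s ≠ 0 → s ≠ q₀ → s ≠ -q₀ →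
    Rp s = Rm s * expDelta q₀ σ x t s * d.K s * expNegDelta q₀ σ x t s
  /-- `R^± = R_∞^± + O(1/z)` at infinity. -/
  infty_plus : ∀ i j, (fun z => Rp z i j - RinfPlus q₀ qp qm i j)
    =O[Bornology.cobounded ℂ ⊓ 𝓟 DPlus] fun z => z⁻¹
  infty_minus : ∀ i j, (fun z => Rm z i j - RinfMinus q₀ qp qm i j)
    =O[Bornology.cobounded ℂ ⊓ 𝓟 DMinus] fun z => z⁻¹
  /-- `R^± = R₀^±/z + O(1)` at the origin. -/
  zero_plus : ∀ i j, (fun z => Rp z i j - z⁻¹ * RzeroPlus q₀ i j)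
    =O[𝓝[DPlus] 0] fun _ => (1 : ℂ)
  zero_minus : ∀ i j, (fun z => Rm z i j - z⁻¹ * RzeroMinus qm i j)
    =O[𝓝[DMinus] 0] fun _ => (1 : ℂ)
  /-- `R^±` stay finite at the branch points `±q₀`. -/
  branch_plus : ∀ i j, ∀ b ∈ ({(q₀ : ℂ), -(q₀ : ℂ)} : Set ℂ),
    (fun z => Rp z i j) =O[𝓝[DPlus] b] fun _ => (1 : ℂ)
  branch_minus : ∀ i j, ∀ b ∈ ({(q₀ : ℂ), -(q₀ : ℂ)} : Set ℂ),
    (fun z => Rm z i j) =O[𝓝[DMinus] b] fun _ => (1 : ℂ)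
  /-- The residue conditions. -/
  res_z : ∀ m, matResidue Rp (d.z m) = Rp (d.z m) *
    !![0, 0, 0; 0, 0, 0; I * d.C σ x t m * rho q₀ (d.z m), 0, 0]
  res_zc : ∀ m, matResidue Rm (d.zc m) = Rm (d.zc m) *
    !![0, 0, I * d.Cbar σ x t m * rho q₀ (d.zc m); 0, 0, 0; 0, 0, 0]
  res_θ : ∀ m, matResidue Rp (d.θ m) = Rp (d.θ m) *
    !![0, 0, 0; -d.F σ x t m, 0, 0; 0, 0, 0]
  res_θc : ∀ m, matResidue Rm (d.θc m) = Rm (d.θc m) *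
    !![0, I * d.Fbar σ x t m * rho q₀ (d.θc m), 0; 0, 0, 0; 0, 0, 0]
  res_θi : ∀ m, matResidue Rm (d.θi m) = Rm (d.θi m) *
    !![0, 0, 0; 0, 0, d.Fcheck σ x t m; 0, 0, 0]
  res_θic : ∀ m, matResidue Rp (d.θic m) = Rp (d.θic m) *
    !![0, 0, 0; 0, 0, 0; 0, -(I * d.Fhat σ x t m * rho q₀ (d.θic m)), 0]

/-! ### The terms of the solution formula -/

/-- The object that equals `P` in the upper and `N` in the lower half-plane. -/
def sectional {α : Type*} (P N : α) (z : ℂ) : α := if 0 < z.im then P else N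

/-- The density
`R_∞^∇ + R₀^∇/ζ + R⁻(ζ) e^{iΔ(ζ)} L(ζ) e^{-iΔ(ζ)}` with `R^∇ = R⁻ - R⁺`. -/
def density {q₀ : ℝ} {M₁ M₂ : ℕ} (σ x t : ℝ) (qp qm : Vec2)
    (d : SpectralData q₀ M₁ M₂) (Rm : ℂ → Mat3) (s : ℝ) : Mat3 :=
  (RinfMinus q₀ qp qm - RinfPlus q₀ qp qm)
    + (s : ℂ)⁻¹ • (RzeroMinus qm - RzeroPlus q₀)
    + Rm s * expDelta q₀ σ x t s * d.L s * expNegDelta q₀ σ x t s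

/-- `(2πi)⁻¹ ∫_ℝ A(ζ) dζ/(ζ - z)`, entrywise. -/
def cauchyIntegral (A : ℝ → Mat3) (z : ℂ) : Mat3 :=
  Matrix.of fun i j => (2 * Real.pi * I)⁻¹ * ∫ s : ℝ, A s i j / ((s : ℂ) - z)

end HirotaRH

end

noncomputable section

namespace HirotaRH

open Bornology

/-! ### Cauchy's theorem in the upper half-plane -/

/-! The formula is the Plemelj representation, applied entry by entry. From `Rp` and `Rm` one
subtracts the value at infinity, the pole at the origin and the principal parts at all points of the
discrete spectrum, those of both half-planes in each case. The remainders `F` above and `G` below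
are analytic in their half-planes, bounded near every real point and `O(1/z)` at infinity
(`exists_hasCauchyDecay`). On the real line the principal parts cancel in `F - G`, and the jump
condition identifies what is left with the density (`density_eq`).

The Cauchy transform of the boundary values of `F` is `F` above and `0` below the line, and that of
`-G` is `0` above and `G` below (`HasCauchyDecay.plemelj`). Both facts come from Cauchy's theorem on
a horizontal line that is lowered to the real axis. The kernel supplies a second factor `1/z`, which
also gives the absolute convergence.

The column formulas follow because each residue matrix has at most one nonzero column. They also
hold at spectral points where the column in question is analytic, since its residue there is zero.
-/

theorem isOpen_DPlus : IsOpen DPlus := isOpen_lt continuous_const continuous_im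

theorem isOpen_DMinus : IsOpen DMinus := isOpen_lt continuous_im continuous_const

/-- A continuous function on the upper half-plane that is locally bounded up to the boundary and
`O(z⁻²)` at infinity is bounded by a multiple of `(1 + |z|²)⁻¹`. -/
theorem exists_bound_of_isBigO {f : ℂ → ℂ} (hc : ContinuousOn f DPlus)
    (hloc : ∀ s : ℝ, f =O[𝓝[DPlus] (s : ℂ)] fun _ => (1 : ℂ))
    (hinf : f =O[cobounded ℂ ⊓ 𝓟 DPlus] fun z => (z ^ 2)⁻¹) :
    ∃ C, 0 ≤ C ∧ ∀ z ∈ DPlus, ‖f z‖ ≤ C * (1 + ‖z‖ ^ 2)⁻¹ := by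
  obtain ⟨c, hc0, hcb⟩ := hinf.exists_pos
  rw [IsBigOWith, eventually_inf_principal,
    hasBasis_cobounded_norm.eventually_iff] at hcb
  obtain ⟨R, -, hR⟩ := hcb
  have hK : IsCompact (Metric.closedBall (0 : ℂ) (max R 1) ∩ {z : ℂ | 0 ≤ z.im}) :=
    (isCompact_closedBall _ _).inter_right (isClosed_le continuous_const continuous_im)
  have hM : ∃ M, ∀ z ∈ (Metric.closedBall (0 : ℂ) (max R 1) ∩ {z : ℂ | 0 ≤ z.im}),
      z ∈ DPlus → ‖f z‖ ≤ M := by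
    -- Compactness of the closed half-disc glues local bounds into one. At real points the local
    -- bound is `hloc`, elsewhere it is continuity.
    refine hK.induction_on (p := fun s => ∃ M, ∀ z ∈ s, z ∈ DPlus → ‖f z‖ ≤ M)
      ⟨0, by simp⟩ ?_ ?_ ?_
    · rintro s u hsu ⟨M, hM⟩
      exact ⟨M, fun z hz => hM z (hsu hz)⟩
    · rintro s u ⟨M, hM⟩ ⟨N, hN⟩
      refine ⟨max M N, ?_⟩
      rintro z (hz | hz) hzD
      · exact (hM z hz hzD).trans (le_max_left _ _)
      · exact (hN z hz hzD).trans (le_max_right _ _)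
    · intro z hz
      have hO : f =O[𝓝[DPlus] z] fun _ => (1 : ℂ) := by
        rcases (show 0 ≤ z.im from hz.2).eq_or_lt with h | h
        · have : z = (z.re : ℂ) := by apply Complex.ext <;> simp [← h]
          rw [this]; exact hloc _
        · exact (hc z h).isBigO_one ℂ
      obtain ⟨M, hM⟩ := hO.bound
      refine ⟨{w | w ∈ DPlus → ‖f w‖ ≤ M}, ?_, M, fun w hw => hw⟩
      apply mem_nhdsWithin_of_mem_nhds
      rw [eventually_nhdsWithin_iff] at hM
      filter_upwards [hM] with w hw hwD
      simpa using hw hwD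
  obtain ⟨M, hM⟩ := hM
  have hM0 : 0 ≤ max M 0 := le_max_right _ _
  -- The first term serves `‖z‖ ≤ max R 1`. Outside, `‖f z‖ ≤ c / ‖z‖²` and `1 + ‖z‖² ≤ 2 ‖z‖²` give
  -- `2 * c`.
  refine ⟨max M 0 * (1 + (max R 1) ^ 2) + 2 * c, by positivity, fun z hz => ?_⟩
  have hpos : (0 : ℝ) < 1 + ‖z‖ ^ 2 := by positivity
  rw [← div_eq_mul_inv, le_div_iff₀ hpos]
  by_cases hzR : ‖z‖ ≤ max R 1
  · have h1 : ‖f z‖ ≤ max M 0 :=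
      (hM z ⟨by simpa using hzR, (show 0 < z.im from hz).le⟩ hz).trans (le_max_left _ _)
    have h2 : 1 + ‖z‖ ^ 2 ≤ 1 + (max R 1) ^ 2 := by gcongr
    calc ‖f z‖ * (1 + ‖z‖ ^ 2) ≤ max M 0 * (1 + (max R 1) ^ 2) := by gcongr
      _ ≤ _ := by linarith
  · push Not at hzR
    have h1 := hR (x := z) ((le_max_left _ _).trans hzR.le) hz
    have h2 : 1 ≤ ‖z‖ := (le_max_right _ _).trans hzR.le
    have h3 : 0 < ‖z‖ ^ 2 := by positivity
    rw [norm_inv, norm_pow, ← div_eq_mul_inv, le_div_iff₀ h3] at h1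
    have h4 : ‖f z‖ ≤ ‖f z‖ * ‖z‖ ^ 2 := le_mul_of_one_le_right (norm_nonneg _) (one_le_pow₀ h2)
    have h5 : 0 ≤ max M 0 * (1 + (max R 1) ^ 2) := by positivity
    nlinarith

theorem norm_ofReal_add_sq (s y : ℝ) : ‖(s : ℂ) + y * I‖ ^ 2 = s ^ 2 + y ^ 2 := by
  rw [← normSq_eq_norm_sq, normSq_add_mul_I]

/-- The integral of a function that is analytic in the upper half-plane and `O((1 + |z|²)⁻¹)`
vanishes along every horizontal line. -/
theorem integral_horizontal_eq_zero {f : ℂ → ℂ} {C : ℝ} (hd : DifferentiableOn ℂ f DPlus)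
    (hC : 0 ≤ C) (hb : ∀ z ∈ DPlus, ‖f z‖ ≤ C * (1 + ‖z‖ ^ 2)⁻¹) {ε : ℝ} (hε : 0 < ε) :
    ∫ s : ℝ, f (s + ε * I) = 0 := by
  have hmem : ∀ s y : ℝ, 0 < y → (s : ℂ) + y * I ∈ DPlus := fun s y hy => by simpa [DPlus] using hy
  have hcont : Continuous fun s : ℝ => f (s + ε * I) :=
    hd.continuousOn.comp_continuous (by fun_prop) fun s => hmem s ε hε
  have hint : Integrable fun s : ℝ => f (s + ε * I) := by
    refine (integrable_inv_one_add_sq.const_mul C).mono' hcont.aestronglyMeasurable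
      (ae_of_all _ fun s => (hb _ (hmem s ε hε)).trans ?_)
    rw [norm_ofReal_add_sq]
    gcongr
    nlinarith
  have hlim := intervalIntegral_tendsto_integral hint tendsto_neg_atTop_atBot
    (tendsto_id (α := ℝ) (x := atTop))
  refine tendsto_nhds_unique hlim (squeeze_zero_norm' (a := fun R : ℝ => 4 * C * R⁻¹) ?_ ?_)
  · filter_upwards [eventually_gt_atTop 0] with R hR
    -- The rectangle is `[-R, R] × [ε, ε + R]`. Its three sides other than the base have total
    -- length `4R` and lie in `‖z‖ ≥ R`, where `f` is at most `C / R²`, so the base integral is at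
    -- most `4C / R`.
    have hrect := integral_boundary_rect_eq_zero_of_differentiableOn f
      (((-R : ℝ) : ℂ) + ε * I) (R + ((ε + R : ℝ) : ℂ) * I) (hd.mono (by
        intro z hz
        have := hz.2
        simp only [add_im, ofReal_im, mul_im, ofReal_re, I_im, mul_one, I_re, mul_zero, add_zero,
          zero_add, Set.mem_preimage] at this
        rw [Set.uIcc_of_le (by linarith)] at this
        exact hε.trans_le this.1))
    simp only [add_im, ofReal_im, mul_im, ofReal_re, I_im, mul_one, I_re, mul_zero, add_zero,
      zero_add, add_re, mul_re, sub_zero] at hrect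
    have key : ∀ s y : ℝ, 0 < y → R ^ 2 ≤ s ^ 2 + y ^ 2 →
        ‖f (s + y * I)‖ ≤ C * (R ^ 2)⁻¹ := fun s y hy h => by
      refine (hb _ (hmem s y hy)).trans ?_
      rw [norm_ofReal_add_sq]
      gcongr
      linarith
    have htop : ‖∫ x in (-R)..R, f (x + ((ε + R : ℝ) : ℂ) * I)‖ ≤ C * (R ^ 2)⁻¹ * |R - (-R)| :=
      intervalIntegral.norm_integral_le_of_norm_le_const fun s _ =>
        key s (ε + R) (by positivity) (by nlinarith [sq_nonneg s])
    have hside : ∀ a : ℝ, a ^ 2 = R ^ 2 →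
        ‖I • ∫ y in ε..(ε + R), f ((a : ℂ) + y * I)‖ ≤ C * (R ^ 2)⁻¹ * |ε + R - ε| := fun a ha => by
      rw [norm_smul, norm_I, one_mul]
      refine intervalIntegral.norm_integral_le_of_norm_le_const fun y hy => ?_
      rw [Set.uIoc_of_le (by linarith)] at hy
      exact key a y (hε.trans hy.1) (by nlinarith [sq_nonneg y])
    have hr := hside R rfl
    have hl := hside (-R) (by ring)
    rw [show R - -R = 2 * R by ring, abs_of_pos (by positivity)] at htop
    rw [add_sub_cancel_left, abs_of_pos hR] at hr hl
    have heq : ∫ s in (-R)..R, f (s + ε * I) =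
        (∫ x in (-R)..R, f (x + ((ε + R : ℝ) : ℂ) * I))
          - I • (∫ y in ε..(ε + R), f ((R : ℂ) + y * I))
          + I • ∫ y in ε..(ε + R), f (((-R : ℝ) : ℂ) + y * I) := by
      linear_combination hrect
    simp only [id]
    rw [heq]
    calc _ ≤ C * (R ^ 2)⁻¹ * (2 * R) + C * (R ^ 2)⁻¹ * R + C * (R ^ 2)⁻¹ * R :=
          (norm_add_le _ _).trans (add_le_add ((norm_sub_le _ _).trans (add_le_add htop hr)) hl)
      _ = 4 * C * R⁻¹ := by field_simp; ring
  · simpa using tendsto_inv_atTop_zero.const_mul (4 * C)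

/-- Cauchy's theorem for the boundary values of an analytic function in the upper half-plane
that is locally bounded up to the boundary and `O(z⁻²)` at infinity. -/
theorem integral_boundaryValue_eq_zero {f : ℂ → ℂ} (hd : DifferentiableOn ℂ f DPlus)
    (hloc : ∀ s : ℝ, f =O[𝓝[DPlus] (s : ℂ)] fun _ => (1 : ℂ))
    (hinf : f =O[cobounded ℂ ⊓ 𝓟 DPlus] fun z => (z ^ 2)⁻¹)
    (hbd : ∀ᵐ s : ℝ, Tendsto f (𝓝[DPlus] (s : ℂ)) (𝓝 (f s))) :
    (Integrable fun s : ℝ => f s) ∧ ∫ s : ℝ, f s = 0 := by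
  obtain ⟨C, hC, hb⟩ := exists_bound_of_isBigO hd.continuousOn hloc hinf
  set ε : ℕ → ℝ := fun n => ((n : ℝ) + 1)⁻¹ with hε
  have hε0 : ∀ n, 0 < ε n := fun n => by positivity
  have hεlim : Tendsto ε atTop (𝓝 0) := by
    simpa [hε, one_div] using tendsto_one_div_add_atTop_nhds_zero_nat (𝕜 := ℝ)
  have hmem : ∀ (s : ℝ) n, (s : ℂ) + ε n * I ∈ DPlus := fun s n => by simpa [DPlus] using hε0 n
  have hmeas : ∀ n, AEStronglyMeasurable (fun s : ℝ => f (s + ε n * I)) volume := fun n =>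
    (hd.continuousOn.comp_continuous (by fun_prop) fun s => hmem s n).aestronglyMeasurable
  have hbound : ∀ n (s : ℝ), ‖f (s + ε n * I)‖ ≤ C * (1 + s ^ 2)⁻¹ := fun n s => by
    refine (hb _ (hmem s n)).trans ?_
    rw [norm_ofReal_add_sq]
    gcongr
    nlinarith [hε0 n]
  have hlim : ∀ᵐ s : ℝ, Tendsto (fun n => f (s + ε n * I)) atTop (𝓝 (f s)) := by
    filter_upwards [hbd] with s hs
    refine hs.comp (tendsto_nhdsWithin_iff.2 ⟨?_, Eventually.of_forall (hmem s)⟩)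
    have : Tendsto (fun n => (s : ℂ) + ε n * I) atTop (𝓝 ((s : ℂ) + ((0 : ℝ) : ℂ) * I)) :=
      tendsto_const_nhds.add (((continuous_ofReal.tendsto 0).comp hεlim).mul_const I)
    simpa using this
  have hint := integrable_inv_one_add_sq.const_mul C
  -- Measurability of the boundary values is not assumed; they inherit it as an almost everywhere
  -- limit along the lines of height `ε n`. The majorant `C (1 + s²)⁻¹` does not depend on `n`.
  refine ⟨hint.mono' (aestronglyMeasurable_of_tendsto_ae atTop hmeas hlim) ?_, ?_⟩
  · filter_upwards [hlim] with s hs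
    exact le_of_tendsto hs.norm (Eventually.of_forall fun n => hbound n s)
  · have := tendsto_integral_of_dominated_convergence _ hmeas hint
      (fun n => ae_of_all _ (hbound n)) hlim
    simp only [integral_horizontal_eq_zero hd hC hb (hε0 _)] at this
    exact tendsto_nhds_unique this tendsto_const_nhds

/-! ### The Cauchy transform of boundary values -/

theorem isBigO_inv_sub (p : ℂ) : (fun z : ℂ => (z - p)⁻¹) =O[cobounded ℂ] fun z => z⁻¹ := by
  have h : (fun z : ℂ => z) =O[cobounded ℂ] fun z => z - p := by
    have := (IsEquivalent.refl (u := fun z : ℂ => z)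
      (l := cobounded ℂ)).sub_isLittleO (isLittleO_const_id_cobounded p)
    exact this.symm.isBigO
  refine h.inv_rev ?_
  filter_upwards [eventually_ne_cobounded (0 : ℂ)] with z hz h0
  exact absurd h0 hz

theorem isBigO_one_inv_sub {p c : ℂ} (h : c ≠ p) (U : Set ℂ) :
    (fun z : ℂ => (z - p)⁻¹) =O[𝓝[U] c] fun _ => (1 : ℂ) := by
  have : ContinuousAt (fun z : ℂ => (z - p)⁻¹) c :=
    ContinuousAt.inv₀ (by fun_prop) (sub_ne_zero.2 h)
  exact (this.continuousWithinAt (s := U)).isBigO_one ℂ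

/-- `F` is analytic in `U`, locally bounded up to the real line, `O(1/z)` at infinity, and its
values on the real line are almost everywhere the limits from `U`. -/
structure HasCauchyDecay (U : Set ℂ) (F : ℂ → ℂ) : Prop where
  differentiableOn : DifferentiableOn ℂ F U
  isBigO_one : ∀ s : ℝ, F =O[𝓝[U] (s : ℂ)] fun _ => (1 : ℂ)
  isBigO_inv : F =O[cobounded ℂ ⊓ 𝓟 U] fun z => z⁻¹
  tendsto_boundary : ∀ᵐ s : ℝ, Tendsto F (𝓝[U] (s : ℂ)) (𝓝 (F s))

theorem ofReal_ne_of_im_ne_zero {z : ℂ} (hz : z.im ≠ 0) (s : ℝ) : (s : ℂ) ≠ z := by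
  rintro rfl
  exact hz (ofReal_im s)

theorem tendsto_inv_sub_ofReal {z : ℂ} (hz : z.im ≠ 0) (s : ℝ) (U : Set ℂ) :
    Tendsto (fun w : ℂ => (w - z)⁻¹) (𝓝[U] (s : ℂ)) (𝓝 ((s : ℂ) - z)⁻¹) := by
  have : ContinuousAt (fun w : ℂ => (w - z)⁻¹) (s : ℂ) :=
    ContinuousAt.inv₀ (by fun_prop) (sub_ne_zero.2 (ofReal_ne_of_im_ne_zero hz s))
  exact this.continuousWithinAt

/-- The Cauchy transform of boundary values from above vanishes in the lower half-plane. -/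
theorem HasCauchyDecay.cauchy_of_im_neg {F : ℂ → ℂ} (hF : HasCauchyDecay DPlus F) {z : ℂ}
    (hz : z.im < 0) :
    (Integrable fun s : ℝ => F s / (s - z)) ∧ ∫ s : ℝ, F s / (s - z) = 0 := by
  -- For `z` below the line the kernel is analytic in the upper half-plane and improves the decay
  -- from `1/w` to `1/w²`.
  refine integral_boundaryValue_eq_zero (f := fun w => F w / (w - z)) ?_ ?_ ?_ ?_
  · refine hF.differentiableOn.div (by fun_prop) fun w hw => sub_ne_zero.2 ?_
    rintro rfl
    exact (hz.trans hw).false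
  · intro s
    simpa [div_eq_mul_inv] using
      (hF.isBigO_one s).mul (isBigO_one_inv_sub (ofReal_ne_of_im_ne_zero hz.ne s) DPlus)
  · simpa [div_eq_mul_inv, sq] using
      hF.isBigO_inv.mul ((isBigO_inv_sub z).mono inf_le_left)
  · filter_upwards [hF.tendsto_boundary] with s hs
    simpa [div_eq_mul_inv] using hs.mul (tendsto_inv_sub_ofReal hz.ne s DPlus)

/-- The integral of the Poisson kernel. -/
theorem integral_inv_mul_conj {z : ℂ} (hz : 0 < z.im) :
    (Integrable fun s : ℝ => (((s : ℂ) - z) * (s - (starRingEnd ℂ) z))⁻¹) ∧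
      ∫ s : ℝ, (((s : ℂ) - z) * (s - (starRingEnd ℂ) z))⁻¹ = Real.pi / z.im := by
  -- For real `s` the two factors are conjugate, so the integrand is `|s - z|⁻²`, a translated and
  -- rescaled `(1 + s²)⁻¹`.
  have hfun : (fun s : ℝ => (((s : ℂ) - z) * (s - (starRingEnd ℂ) z))⁻¹)
      = fun s : ℝ => (((z.im ^ 2)⁻¹ * (1 + ((s - z.re) / z.im) ^ 2)⁻¹ : ℝ) : ℂ) := by
    funext s
    rw [← mul_inv, ofReal_inv]
    congr 1
    have h1 : (s : ℂ) - (starRingEnd ℂ) z = (starRingEnd ℂ) ((s : ℂ) - z) := by simp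
    rw [h1, mul_conj, normSq_apply]
    congr 1
    simp
    field_simp
    ring
  have hint : ∫ s : ℝ, (z.im ^ 2)⁻¹ * (1 + ((s - z.re) / z.im) ^ 2)⁻¹ = Real.pi / z.im := by
    rw [integral_const_mul,
      integral_sub_right_eq_self (f := fun x : ℝ ↦ (1 + (x / z.im) ^ 2)⁻¹),
      Measure.integral_comp_div (g := fun x : ℝ ↦ (1 + x ^ 2)⁻¹), integral_univ_inv_one_add_sq,
      smul_eq_mul, abs_of_pos hz]
    field_simp
  -- A non-integrable function would have the default integral `0`, whereas this one is positive.
  have hi : Integrable fun s : ℝ => (z.im ^ 2)⁻¹ * (1 + ((s - z.re) / z.im) ^ 2)⁻¹ :=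
    Integrable.of_integral_ne_zero (by rw [hint]; positivity)
  rw [hfun]
  refine ⟨hi.ofReal, ?_⟩
  rw [integral_complex_ofReal, hint, ofReal_div]

/-- Cauchy's integral formula for boundary values from above. -/
theorem HasCauchyDecay.cauchy_of_im_pos {F : ℂ → ℂ} (hF : HasCauchyDecay DPlus F) {z : ℂ}
    (hz : 0 < z.im) :
    (Integrable fun s : ℝ => F s / (s - z)) ∧
      ∫ s : ℝ, F s / (s - z) = 2 * Real.pi * I * F z := by
  -- The correction `c / (w - z̄)` is analytic above the line, decays like `1/w` and equals `F z` at
  -- `w = z`; subtracting the constant `F z` would destroy the decay. Hence `G` vanishes at `z`,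
  -- `dslope G z` continues `G w / (w - z)` analytically and has integral zero. The correction
  -- contributes `c π / Im z = 2πi F z`, because `z - z̄ = 2i Im z`.
  set c : ℂ := F z * (z - (starRingEnd ℂ) z) with hc
  have hzc : ((starRingEnd ℂ) z).im < 0 := by simpa using hz
  have hzz : z - (starRingEnd ℂ) z ≠ 0 := sub_ne_zero.2 fun h => by
    rw [← h] at hzc; exact (hz.trans hzc).false
  set G : ℂ → ℂ := fun w => F w - c * (w - (starRingEnd ℂ) z)⁻¹ with hG
  have hGz : G z = 0 := by simp [hG, hc, hzz]
  have hGd : DifferentiableOn ℂ G DPlus := by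
    refine hF.differentiableOn.sub ((DifferentiableOn.inv (by fun_prop) fun w hw =>
      sub_ne_zero.2 ?_).const_mul c)
    rintro rfl
    exact (hzc.trans hw).false
  have hslope : ∀ w, w ≠ z → dslope G z w = G w * (w - z)⁻¹ := fun w hw => by
    rw [dslope_of_ne _ hw, slope_def_field, hGz, sub_zero, div_eq_mul_inv]
  have hGO : ∀ s : ℝ, G =O[𝓝[DPlus] (s : ℂ)] fun _ => (1 : ℂ) := fun s =>
    (hF.isBigO_one s).sub
      ((isBigO_one_inv_sub (ofReal_ne_of_im_ne_zero hzc.ne s) DPlus).const_mul_left c)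
  have hGinf : G =O[cobounded ℂ ⊓ 𝓟 DPlus] fun w => w⁻¹ :=
    hF.isBigO_inv.sub (((isBigO_inv_sub _).mono inf_le_left).const_mul_left c)
  have hmain := integral_boundaryValue_eq_zero (f := dslope G z)
    ((differentiableOn_dslope (isOpen_DPlus.mem_nhds hz)).2 hGd) (fun s => by
      refine ((hGO s).mul (isBigO_one_inv_sub
        (ofReal_ne_of_im_ne_zero hz.ne' s) DPlus)).congr' ?_ (by simp)
      have : ∀ᶠ w in 𝓝 (s : ℂ), w ≠ z := eventually_ne_nhds (ofReal_ne_of_im_ne_zero hz.ne' s)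
      filter_upwards [mem_nhdsWithin_of_mem_nhds this] with w hw using (hslope w hw).symm) (by
      refine (hGinf.mul ((isBigO_inv_sub z).mono inf_le_left)).congr' ?_
        (Eventually.of_forall fun w => by simp [sq])
      filter_upwards [(eventually_ne_cobounded z).filter_mono inf_le_left] with w hw
        using (hslope w hw).symm) (by
      filter_upwards [hF.tendsto_boundary] with s hs
      rw [hslope _ (ofReal_ne_of_im_ne_zero hz.ne' s)]
      refine ((hs.sub ((tendsto_inv_sub_ofReal hzc.ne s DPlus).const_mul c)).mul
        (tendsto_inv_sub_ofReal hz.ne' s DPlus)).congr' ?_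
      have : ∀ᶠ w in 𝓝 (s : ℂ), w ≠ z := eventually_ne_nhds (ofReal_ne_of_im_ne_zero hz.ne' s)
      filter_upwards [mem_nhdsWithin_of_mem_nhds this] with w hw using (hslope w hw).symm)
  obtain ⟨hPi, hPv⟩ := integral_inv_mul_conj hz
  have hsplit : (fun s : ℝ => F s / (s - z)) = fun s : ℝ => dslope G z s
      + c * (((s : ℂ) - z) * (s - (starRingEnd ℂ) z))⁻¹ := by
    funext s
    rw [hslope _ (ofReal_ne_of_im_ne_zero hz.ne' s), mul_inv, div_eq_mul_inv]
    simp only [hG]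
    ring
  rw [hsplit]
  refine ⟨hmain.1.add (hPi.const_mul c), ?_⟩
  rw [integral_add hmain.1 (hPi.const_mul c), hmain.2, integral_const_mul, hPv, hc, sub_conj]
  have : (z.im : ℂ) ≠ 0 := by exact_mod_cast hz.ne'
  push_cast
  field_simp
  ring

/-- The map `z ↦ -z` exchanges the half-planes and preserves the real line and its measure, so the
results for the lower half-plane need no second contour argument. -/
theorem HasCauchyDecay.comp_neg {F : ℂ → ℂ} (hF : HasCauchyDecay DMinus F) :
    HasCauchyDecay DPlus fun z => F (-z) := by
  have hmaps : Set.MapsTo (fun z : ℂ => -z) DPlus DMinus := fun z hz => by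
    simpa [DPlus, DMinus] using hz
  have hnhds : ∀ s : ℝ, Tendsto (fun z : ℂ => -z) (𝓝[DPlus] (s : ℂ)) (𝓝[DMinus] ((-s : ℝ) : ℂ)) :=
    fun s => by
      rw [ofReal_neg]
      exact (continuous_neg.tendsto (s : ℂ)).inf (tendsto_principal_principal.2 hmaps)
  have hcob : Tendsto (fun z : ℂ => -z) (cobounded ℂ ⊓ 𝓟 DPlus) (cobounded ℂ ⊓ 𝓟 DMinus) :=
    tendsto_neg_cobounded.inf (tendsto_principal_principal.2 hmaps)
  refine ⟨hF.differentiableOn.comp (by fun_prop) hmaps,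
    fun s => (hF.isBigO_one (-s)).comp_tendsto (hnhds s), ?_, ?_⟩
  · refine (hF.isBigO_inv.comp_tendsto hcob).trans (IsBigO.of_bound 1 ?_)
    simp
  · have := (Measure.measurePreserving_neg (volume : Measure ℝ)).quasiMeasurePreserving.ae
      hF.tendsto_boundary
    filter_upwards [this] with s hs
    simpa [Function.comp_def] using hs.comp (hnhds s)

/-- The sign comes from the kernel, `s - (-z) = -(-s - z)`; Lebesgue measure is invariant under `s ↦
-s`. -/
theorem integrable_and_integral_comp_neg {F : ℂ → ℂ} {z v : ℂ}
    (h : (Integrable fun s : ℝ => F (-s) / (s - -z)) ∧ ∫ s : ℝ, F (-s) / (s - -z) = v) :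
    (Integrable fun s : ℝ => F s / (s - z)) ∧ ∫ s : ℝ, F s / (s - z) = -v := by
  have hfun : (fun s : ℝ => F (-s) / (s - -z)) =
      fun s : ℝ => (fun u : ℝ => -(F u / (u - z))) (-s) := by
    funext s
    simp only [ofReal_neg]
    rw [show (s : ℂ) - -z = -(-s - z) by ring, div_neg]
  obtain ⟨h1, h2⟩ := h
  rw [hfun] at h1 h2
  rw [integral_neg_eq_self (fun u : ℝ => -(F u / (u - z))), integral_neg] at h2
  exact ⟨by simpa using h1.comp_neg.neg, by rw [← h2, neg_neg]⟩

/-- The Cauchy transform of boundary values from below vanishes in the upper half-plane. -/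
theorem HasCauchyDecay.cauchy_minus_of_im_pos {F : ℂ → ℂ} (hF : HasCauchyDecay DMinus F) {z : ℂ}
    (hz : 0 < z.im) :
    (Integrable fun s : ℝ => F s / (s - z)) ∧ ∫ s : ℝ, F s / (s - z) = 0 := by
  simpa using integrable_and_integral_comp_neg
    (hF.comp_neg.cauchy_of_im_neg (z := -z) (by simpa using hz))

/-- Cauchy's integral formula for boundary values from below. -/
theorem HasCauchyDecay.cauchy_minus_of_im_neg {F : ℂ → ℂ} (hF : HasCauchyDecay DMinus F) {z : ℂ}
    (hz : z.im < 0) :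
    (Integrable fun s : ℝ => F s / (s - z)) ∧
      ∫ s : ℝ, F s / (s - z) = -(2 * Real.pi * I * F z) := by
  simpa using integrable_and_integral_comp_neg
    (hF.comp_neg.cauchy_of_im_pos (z := -z) (by simpa using hz))

/-- The Plemelj formula: functions with decay in the two half-planes are the Cauchy transform of
the difference of their boundary values. -/
theorem HasCauchyDecay.plemelj {F G : ℂ → ℂ} (hF : HasCauchyDecay DPlus F)
    (hG : HasCauchyDecay DMinus G) {z : ℂ} (hz : z.im ≠ 0) :
    (Integrable fun s : ℝ => (F s - G s) / (s - z)) ∧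
      (2 * Real.pi * I)⁻¹ * ∫ s : ℝ, (F s - G s) / (s - z) = sectional (F z) (G z) z := by
  have hpi : (2 * Real.pi * I : ℂ) ≠ 0 := by simp [Real.pi_ne_zero]
  simp only [sub_div]
  rcases hz.lt_or_gt with h | h
  · obtain ⟨h1, h2⟩ := hF.cauchy_of_im_neg h
    obtain ⟨h3, h4⟩ := hG.cauchy_minus_of_im_neg h
    refine ⟨h1.sub h3, ?_⟩
    rw [integral_sub h1 h3, h2, h4, sectional, if_neg h.not_gt, zero_sub, neg_neg,
      inv_mul_cancel_left₀ hpi]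
  · obtain ⟨h1, h2⟩ := hF.cauchy_of_im_pos h
    obtain ⟨h3, h4⟩ := hG.cauchy_minus_of_im_pos h
    refine ⟨h1.sub h3, ?_⟩
    rw [integral_sub h1 h3, h2, h4, sectional, if_pos h, sub_zero, inv_mul_cancel_left₀ hpi]

/-! ### Removal of simple poles -/

/-- `limUnder` has meaning only if the limit exists. The factor `z - p` raises the order by one,
hence to at least zero, and a meromorphic function of nonnegative order has a finite limit. -/
theorem AtMostSimplePole.tendsto_residue {f : ℂ → ℂ} {p : ℂ} (h : AtMostSimplePole f p) :
    Tendsto (fun z => (z - p) * f z) (𝓝[≠] p) (𝓝 (residue f p)) := by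
  have hsub : MeromorphicAt (fun z : ℂ => z - p) p := by fun_prop
  have ho : (0 : WithTop ℤ) ≤ meromorphicOrderAt (fun z => (z - p) * f z) p := by
    have h1 : meromorphicOrderAt (fun z : ℂ => z - p) p = 1 := meromorphicOrderAt_id_sub_const
    have := meromorphicOrderAt_mul hsub h.1
    simp only [Pi.mul_def] at this
    rw [this, h1]
    calc (0 : WithTop ℤ) = 1 + (-1) := rfl
      _ ≤ _ := by gcongr; exact h.2
  obtain ⟨c, hc⟩ := tendsto_nhds_of_meromorphicOrderAt_nonneg (hsub.mul h.1) ho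
  have hc' : Tendsto (fun z => (z - p) * f z) (𝓝[≠] p) (𝓝 c) := hc
  rw [residue, hc'.limUnder_eq]
  exact hc'

/-- This allows every spectral point to be treated as a possible pole of every column. -/
theorem _root_.AnalyticAt.atMostSimplePole {f : ℂ → ℂ} {p : ℂ} (h : AnalyticAt ℂ f p) :
    AtMostSimplePole f p :=
  ⟨h.meromorphicAt, le_trans (by decide) h.meromorphicOrderAt_nonneg⟩

/-- Subtracting the principal parts at finitely many simple poles leaves an analytic function. -/
theorem exists_differentiableOn_sub_sum {ι : Type*} {P : ι → ℂ} (hP : Function.Injective P)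
    (r : ι → ℂ) (S : Finset ι) {U : Set ℂ} (hU : IsOpen U) {f : ℂ → ℂ}
    (hd : DifferentiableOn ℂ f (U \ P '' S))
    (hr : ∀ i ∈ S, P i ∈ U → Tendsto (fun z => (z - P i) * f z) (𝓝[≠] P i) (𝓝 (r i))) :
    ∃ F : ℂ → ℂ, DifferentiableOn ℂ F U ∧
      ∀ z ∉ P '' S, F z = f z - ∑ i ∈ S, (z - P i)⁻¹ * r i := by
  classical
  -- The open set must vary: the induction hypothesis removes the other poles on `U \ {P i}`, and
  -- the point `P i` is filled in afterwards.
  induction S using Finset.induction_on generalizing U with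
  | empty => exact ⟨f, by simpa using hd, by simp⟩
  | insert i S hi ih =>
    obtain ⟨F, hF, hFf⟩ := ih (U := U \ {P i}) (hU.sdiff isClosed_singleton)
      (hd.mono (by
        rintro z ⟨⟨hz, hzi⟩, hzS⟩
        refine ⟨hz, ?_⟩
        rw [Finset.coe_insert, Set.image_insert_eq]
        rintro (h | h)
        exacts [hzi h, hzS h]))
      fun j hj hjU => hr j (Finset.mem_insert_of_mem hj) hjU.1
    set G : ℂ → ℂ := fun z => F z - (z - P i)⁻¹ * r i with hG
    have hGf : ∀ z ∉ P '' (insert i S : Finset ι), G z =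
        f z - ∑ j ∈ insert i S, (z - P j)⁻¹ * r j := by
      intro z hz
      rw [Finset.coe_insert, Set.image_insert_eq, Set.mem_insert_iff, not_or] at hz
      simp only [hG]
      rw [hFf z hz.2, Finset.sum_insert hi]
      ring
    have hGd : DifferentiableOn ℂ G (U \ {P i}) := by
      refine hF.sub ((DifferentiableOn.inv (by fun_prop) fun z hz => ?_).mul_const _)
      exact sub_ne_zero.2 hz.2
    by_cases hiU : P i ∈ U
    swap
    · exact ⟨G, by rwa [Set.sdiff_singleton_eq_self hiU] at hGd, hGf⟩
    refine ⟨Function.update G (P i) (limUnder (𝓝[≠] P i) G),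
      differentiableOn_update_limUnder_of_isLittleO (hU.mem_nhds hiU) hGd ?_, ?_⟩
    · have hnS : P i ∉ P '' (S : Set ι) := by
        rw [hP.mem_set_image]
        exact hi
      have hev : ∀ᶠ z in 𝓝[≠] P i, z ∉ P '' (S : Set ι) :=
        mem_nhdsWithin_of_mem_nhds
          ((S.finite_toSet.image P).isClosed.isOpen_compl.mem_nhds hnS)
      have hsum : ContinuousAt (fun z => ∑ j ∈ S, (z - P j)⁻¹ * r j) (P i) := by
        refine tendsto_finsetSum _ fun j hj => ?_
        refine ContinuousAt.mul (ContinuousAt.inv₀ (by fun_prop) ?_) continuousAt_const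
        exact sub_ne_zero.2 fun h => hi (hP h ▸ hj)
      have hz0 : Tendsto (fun z : ℂ => z - P i) (𝓝[≠] P i) (𝓝 0) := by
        have : ContinuousAt (fun z : ℂ => z - P i) (P i) := by fun_prop
        simpa using this.tendsto.mono_left nhdsWithin_le_nhds
      -- This is the hypothesis of Riemann's removable singularity theorem. The value `G (P i)` is
      -- irrelevant: as a constant it is annihilated by the factor `z - P i`.
      have hlim : Tendsto (fun z => (z - P i) * (G z - G (P i))) (𝓝[≠] P i) (𝓝 0) := by
        have h1 := ((hr i (Finset.mem_insert_self _ _) hiU).sub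
          (hz0.mul (hsum.tendsto.mono_left nhdsWithin_le_nhds))).sub
          (hz0.mul (tendsto_const_nhds (x := G (P i))))
        have h2 := h1.sub (tendsto_const_nhds (x := r i))
        simp only [zero_mul, sub_zero, sub_self] at h2
        refine h2.congr' ?_
        filter_upwards [hev, self_mem_nhdsWithin] with z hz hzi
        have hne : z - P i ≠ 0 := sub_ne_zero.2 hzi
        simp only [hG, hFf z hz]
        field_simp
        ring
      rw [isLittleO_iff_tendsto']
      · refine hlim.congr fun z => ?_
        rw [div_inv_eq_mul, mul_comm]
      · filter_upwards [self_mem_nhdsWithin] with z hzi h0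
        exact absurd h0 (inv_ne_zero (sub_ne_zero.2 hzi))
    · intro z hz
      rw [Function.update_of_ne, hGf z hz]
      rintro rfl
      exact hz ⟨i, by simp, rfl⟩

/-- Subtracting the values at infinity, the pole at the origin and the principal parts at the
simple poles off the real line leaves a function with decay. -/
theorem exists_hasCauchyDecay {ι : Type*} [Fintype ι] {P : ι → ℂ} (hP : Function.Injective P)
    (hPim : ∀ i, (P i).im ≠ 0) {U : Set ℂ} (hU : IsOpen U) (hU0 : ∀ z ∈ U, z.im ≠ 0)
    {f : ℂ → ℂ} {a b : ℂ} {r : ι → ℂ} {E : Set ℂ} (hE : E.Finite) (h0 : (0 : ℂ) ∈ E)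
    (hd : DifferentiableOn ℂ f (U \ Set.range P))
    (hr : ∀ i, P i ∈ U → Tendsto (fun z => (z - P i) * f z) (𝓝[≠] P i) (𝓝 (r i)))
    (hbd : ∀ s : ℝ, (s : ℂ) ∉ E → Tendsto f (𝓝[U] (s : ℂ)) (𝓝 (f s)))
    (hzero : (fun z => f z - z⁻¹ * b) =O[𝓝[U] 0] fun _ => (1 : ℂ))
    (hloc : ∀ c ∈ E, c ≠ 0 → f =O[𝓝[U] c] fun _ => (1 : ℂ))
    (hinf : (fun z => f z - a) =O[cobounded ℂ ⊓ 𝓟 U] fun z => z⁻¹) :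
    ∃ F : ℂ → ℂ, HasCauchyDecay U F ∧
      (∀ z ∉ Set.range P, F z = f z - a - z⁻¹ * b - ∑ i, (z - P i)⁻¹ * r i) ∧
      ∀ z ∈ U, ContinuousAt f z → F z = f z - a - z⁻¹ * b - ∑ i, (z - P i)⁻¹ * r i := by
  have hUz : ∀ z ∈ U, z ≠ 0 := fun z hz h => hU0 z hz (by simp [h])
  obtain ⟨H, hH, hHf⟩ := exists_differentiableOn_sub_sum hP r Finset.univ hU
    (by simpa using hd) fun i _ => hr i
  simp only [Finset.coe_univ, Set.image_univ] at hHf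
  set F : ℂ → ℂ := fun z => H z - a - z⁻¹ * b with hF
  have hFf : ∀ z ∉ Set.range P, F z = f z - a - z⁻¹ * b - ∑ i, (z - P i)⁻¹ * r i := by
    intro z hz
    simp only [hF, hHf z hz]
    ring
  have hFd : DifferentiableOn ℂ F U :=
    (hH.sub_const a).sub ((differentiableOn_id.inv hUz).mul_const b)
  have hcl : IsClosed (Set.range P) := (Set.finite_range P).isClosed
  have hreal : ∀ s : ℝ, (s : ℂ) ∉ Set.range P := by
    rintro s ⟨i, hi⟩
    exact ofReal_ne_of_im_ne_zero (hPim i) s hi.symm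
  have hevR : ∀ s : ℝ, ∀ᶠ z in 𝓝[U] (s : ℂ), z ∉ Set.range P := fun s =>
    mem_nhdsWithin_of_mem_nhds (hcl.isOpen_compl.mem_nhds (hreal s))
  have hsumR : ∀ s : ℝ, Tendsto (fun z => ∑ i, (z - P i)⁻¹ * r i) (𝓝[U] (s : ℂ))
      (𝓝 (∑ i, ((s : ℂ) - P i)⁻¹ * r i)) := fun s =>
    tendsto_finsetSum _ fun i _ => (tendsto_inv_sub_ofReal (hPim i) s U).mul_const _
  have hinvR : ∀ c : ℂ, c ≠ 0 → Tendsto (fun z : ℂ => z⁻¹ * b) (𝓝[U] c) (𝓝 (c⁻¹ * b)) :=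
    fun c hc => ((continuousAt_inv₀ hc).tendsto.mono_left nhdsWithin_le_nhds).mul_const b
  have hone : ∀ l : Filter ℂ, (fun _ : ℂ => a) =O[l] fun _ => (1 : ℂ) := fun l =>
    isBigO_const_const a one_ne_zero l
  have hlimR : ∀ s : ℝ, (s : ℂ) ∉ E → Tendsto F (𝓝[U] (s : ℂ)) (𝓝 (F s)) := by
    intro s hs
    have hs0 : (s : ℂ) ≠ 0 := fun h => hs (h ▸ h0)
    rw [hFf s (hreal s)]
    refine ((((hbd s hs).sub_const a).sub (hinvR _ hs0)).sub (hsumR s)).congr' ?_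
    filter_upwards [hevR s] with z hz using (hFf z hz).symm
  refine ⟨F, ⟨hFd, fun s => ?_, ?_, ?_⟩, hFf, ?_⟩
  · by_cases hs : (s : ℂ) ∈ E
    · have heq : (fun z => f z - a - z⁻¹ * b - ∑ i, (z - P i)⁻¹ * r i) =ᶠ[𝓝[U] (s : ℂ)] F := by
        filter_upwards [hevR s] with z hz using (hFf z hz).symm
      refine IsBigO.congr' ?_ heq EventuallyEq.rfl
      refine IsBigO.sub ?_ ((hsumR s).isBigO_one ℂ)
      -- At the origin only the combination `f z - b / z` is bounded; at the other exceptional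
      -- points both terms are bounded separately.
      by_cases hs0 : (s : ℂ) = 0
      · rw [hs0]
        refine (hzero.sub (hone _)).congr_left fun z => ?_
        ring
      · exact ((hloc _ hs hs0).sub (hone _)).sub ((hinvR _ hs0).isBigO_one ℂ)
    · exact (hlimR s hs).isBigO_one ℂ
  · have hev : ∀ᶠ z in cobounded ℂ ⊓ 𝓟 U, z ∉ Set.range P :=
      Eventually.filter_mono inf_le_left (isBounded_def.1 (Set.finite_range P).isBounded)
    refine IsBigO.congr' (f₁ := fun z => f z - a - z⁻¹ * b - ∑ i, (z - P i)⁻¹ * r i) ?_ ?_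
      EventuallyEq.rfl
    · refine (hinf.sub ?_).sub (IsBigO.fun_sum fun i _ => ?_)
      · simpa [mul_comm] using (isBigO_refl (fun z : ℂ => z⁻¹) _).const_mul_left b
      · simpa [mul_comm] using ((isBigO_inv_sub (P i)).mono inf_le_left).const_mul_left (r i)
    · filter_upwards [hev] with z hz using (hFf z hz).symm
  · have hnull : volume ((fun s : ℝ => (s : ℂ)) ⁻¹' E) = 0 :=
      (hE.preimage ofReal_injective.injOn).measure_zero _
    filter_upwards [compl_mem_ae_iff.2 hnull] with s hs using hlimR s hs
  · intro z hz hfz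
    by_cases hzP : z ∈ Set.range P
    swap
    · exact hFf z hzP
    have hev : ∀ᶠ w in 𝓝[≠] z, w ∉ Set.range P := by
      have : (Set.range P \ {z})ᶜ ∈ 𝓝 z :=
        ((Set.finite_range P).sdiff).isClosed.isOpen_compl.mem_nhds (by simp)
      filter_upwards [mem_nhdsWithin_of_mem_nhds this, self_mem_nhdsWithin] with w hw hwz hwP
      exact hw ⟨hwP, hwz⟩
    -- If `f` is continuous at a listed point, the residue there vanishes. The right-hand side is
    -- then continuous at that point, and the identity extends to it from the punctured
    -- neighbourhood.
    have hr0 : ∀ i, P i = z → r i = 0 := by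
      rintro i rfl
      have h1 : ContinuousAt (fun w => (w - P i) * f w) (P i) :=
        ContinuousAt.mul (by fun_prop) hfz
      have h2 := h1.tendsto.mono_left (nhdsWithin_le_nhds (s := {P i}ᶜ))
      simp only [sub_self, zero_mul] at h2
      exact tendsto_nhds_unique (hr i hz) h2
    have hsum : ContinuousAt (fun w => ∑ i, (w - P i)⁻¹ * r i) z := by
      refine tendsto_finsetSum _ fun i _ => ?_
      by_cases hi : P i = z
      · simp [hr0 i hi]
      · exact ContinuousAt.mul (ContinuousAt.inv₀ (by fun_prop) (sub_ne_zero.2 (Ne.symm hi)))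
          continuousAt_const
    have hrhs : ContinuousAt (fun w => f w - a - w⁻¹ * b - ∑ i, (w - P i)⁻¹ * r i) z :=
      ((hfz.sub continuousAt_const).sub
        ((continuousAt_inv₀ (hUz z hz)).mul continuousAt_const)).sub hsum
    have hlhs : ContinuousAt F z := (hFd.differentiableAt (hU.mem_nhds hz)).continuousAt
    refine tendsto_nhds_unique (hlhs.tendsto.mono_left (nhdsWithin_le_nhds (s := {z}ᶜ)))
      ((hrhs.tendsto.mono_left nhdsWithin_le_nhds).congr' ?_)
    filter_upwards [hev] with w hw using (hFf w hw).symm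

/-! ### The discrete spectrum -/

namespace SpectralData

variable {q₀ : ℝ} {M₁ M₂ : ℕ} (d : SpectralData q₀ M₁ M₂)

/-- The points of the discrete spectrum in the upper half-plane. -/
def plusPoint : Fin M₁ ⊕ Fin M₂ ⊕ Fin M₂ → ℂ := Sum.elim d.z (Sum.elim d.θ d.θic)

/-- The points of the discrete spectrum in the lower half-plane. -/
def minusPoint : Fin M₁ ⊕ Fin M₂ ⊕ Fin M₂ → ℂ := Sum.elim d.zc (Sum.elim d.θc d.θi)

/-- All points of the discrete spectrum. -/
def point : (Fin M₁ ⊕ Fin M₂ ⊕ Fin M₂) ⊕ (Fin M₁ ⊕ Fin M₂ ⊕ Fin M₂) → ℂ :=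
  Sum.elim d.plusPoint d.minusPoint

theorem θ_ne_zero (m : Fin M₂) : d.θ m ≠ 0 := fun h => by
  have := d.θ_im_pos m
  simp [h] at this

theorem θic_eq (m : Fin M₂) : d.θic m = (starRingEnd ℂ) (d.θi m) := by
  simp [θic, θi]

theorem θi_im_neg (hq₀ : 0 < q₀) (m : Fin M₂) : (d.θi m).im < 0 := by
  have h1 := d.θ_im_pos m
  have h2 : 0 < normSq (d.θ m) := normSq_pos.2 (d.θ_ne_zero m)
  have h3 : d.θi m = ((q₀ ^ 2 : ℝ) : ℂ) * (d.θ m)⁻¹ := by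
    simp [θi, div_eq_mul_inv]
  rw [h3, im_ofReal_mul, inv_im, neg_div]
  have : 0 < q₀ ^ 2 * ((d.θ m).im / normSq (d.θ m)) := by positivity
  linarith

theorem lt_norm_θi (hq₀ : 0 < q₀) (m : Fin M₂) : q₀ < ‖d.θi m‖ := by
  have h1 : 0 < ‖d.θ m‖ := norm_pos_iff.2 (d.θ_ne_zero m)
  rw [θi, norm_div, norm_pow, norm_real, Real.norm_of_nonneg hq₀.le, lt_div_iff₀ h1]
  nlinarith [d.θ_norm_lt m]

theorem θi_injective (hq₀ : 0 < q₀) : Function.Injective d.θi := fun m n h => by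
  have hq : (q₀ : ℂ) ≠ 0 := by exact_mod_cast hq₀.ne'
  have hm := d.θ_ne_zero m
  have hn := d.θ_ne_zero n
  simp only [θi] at h
  field_simp at h
  exact d.θ_injective h.symm

theorem plusPoint_im_pos (hq₀ : 0 < q₀) (k) : 0 < (d.plusPoint k).im := by
  rcases k with m | m | m
  · exact d.z_im_pos m
  · exact d.θ_im_pos m
  · simpa [plusPoint, θic_eq] using d.θi_im_neg hq₀ m

theorem minusPoint_eq (k) : d.minusPoint k = (starRingEnd ℂ) (d.plusPoint k) := by
  rcases k with m | m | m
  · rfl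
  · rfl
  · simp [minusPoint, plusPoint, θic_eq]

theorem minusPoint_im_neg (hq₀ : 0 < q₀) (k) : (d.minusPoint k).im < 0 := by
  simpa [minusPoint_eq] using d.plusPoint_im_pos hq₀ k

theorem norm_θic (m : Fin M₂) : ‖d.θic m‖ = ‖d.θi m‖ := by
  rw [θic_eq, RCLike.norm_conj]

/-- The modulus separates the three families: `θ_m` lies inside the circle of radius `q₀`, `z_m` on
it and `q₀²/θ_m*` outside. -/
theorem plusPoint_injective (hq₀ : 0 < q₀) : Function.Injective d.plusPoint := by
  refine d.z_injective.sumElim (d.θ_injective.sumElim ?_ ?_) ?_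
  · intro m n h
    rw [θic_eq, θic_eq] at h
    exact d.θi_injective hq₀ ((starRingEnd ℂ).injective h)
  · intro m n h
    have h1 := d.θ_norm_lt m
    have h2 := d.lt_norm_θi hq₀ n
    rw [h, norm_θic] at h1
    exact (h1.trans h2).false
  · rintro m (n | n) h
    · have h1 := d.θ_norm_lt n
      have h2 := d.z_norm m
      rw [h] at h2
      exact h1.ne h2
    · have h1 := d.lt_norm_θi hq₀ n
      have h2 := d.z_norm m
      rw [h] at h2
      simp only [Sum.elim_inr, norm_θic] at h2
      exact h1.ne' h2

theorem point_injective (hq₀ : 0 < q₀) : Function.Injective d.point := by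
  refine (d.plusPoint_injective hq₀).sumElim (fun k l h => ?_) fun k l h => ?_
  · rw [minusPoint_eq, minusPoint_eq] at h
    exact d.plusPoint_injective hq₀ ((starRingEnd ℂ).injective h)
  · have h1 := d.plusPoint_im_pos hq₀ k
    have h2 := d.minusPoint_im_neg hq₀ l
    rw [h] at h1
    exact (h1.trans h2).false

theorem point_im_ne_zero (hq₀ : 0 < q₀) (k) : (d.point k).im ≠ 0 := by
  rcases k with k | k
  · exact (d.plusPoint_im_pos hq₀ k).ne'
  · exact (d.minusPoint_im_neg hq₀ k).ne

theorem polesPlus_subset (j : Fin 3) : d.polesPlus j ⊆ Set.range d.point := by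
  fin_cases j
  · rintro _ (⟨m, rfl⟩ | ⟨m, rfl⟩)
    exacts [⟨.inl (.inl m), rfl⟩, ⟨.inl (.inr (.inl m)), rfl⟩]
  · rintro _ ⟨m, rfl⟩
    exact ⟨.inl (.inr (.inr m)), rfl⟩
  · exact fun _ h => h.elim

theorem polesMinus_subset (j : Fin 3) : d.polesMinus j ⊆ Set.range d.point := by
  fin_cases j
  · exact fun _ h => h.elim
  · rintro _ ⟨m, rfl⟩
    exact ⟨.inr (.inr (.inl m)), rfl⟩
  · rintro _ (⟨m, rfl⟩ | ⟨m, rfl⟩)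
    exacts [⟨.inr (.inl m), rfl⟩, ⟨.inr (.inr (.inr m)), rfl⟩]

theorem point_mem_spectrum (k) : d.point k ∈ d.spectrum := by
  rcases k with (m | m | m) | (m | m | m) <;>
    simp [point, plusPoint, minusPoint, spectrum]

end SpectralData

/-! ### Solutions of the Riemann-Hilbert problem -/

/-- Used with `U` an open half-plane, `V` its closure, `T` the poles and `E = {0, ±q₀}`: near `c`
all of `U` lies in the set of continuity. -/
theorem tendsto_nhdsWithin_of_continuousOn_sdiff {f : ℂ → ℂ} {U V T E : Set ℂ} (hT : IsClosed T)
    (hUV : U ⊆ V) (hE : IsClosed E) (hf : ContinuousOn f (V \ (T ∪ E))) {c : ℂ} (hc : c ∈ V)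
    (hcT : c ∉ T) (hcE : c ∉ E) : Tendsto f (𝓝[U] c) (𝓝 (f c)) := by
  have h1 : ContinuousWithinAt f (V \ (T ∪ E)) c := hf c ⟨hc, by simp [hcT, hcE]⟩
  refine h1.mono_of_mem_nhdsWithin ?_
  filter_upwards [self_mem_nhdsWithin, mem_nhdsWithin_of_mem_nhds
    ((hT.union hE).isOpen_compl.mem_nhds (by simp [hcT, hcE] : c ∈ (T ∪ E)ᶜ))] with z hz hz'
  exact ⟨hUV hz, hz'⟩

namespace IsRHSolution

variable {q₀ σ x t : ℝ} {qp qm : Vec2} {M₁ M₂ : ℕ} {d : SpectralData q₀ M₁ M₂} {Rp Rm : ℂ → Mat3}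

/-- The residues of a solution at the points of the discrete spectrum. -/
def residues (d : SpectralData q₀ M₁ M₂) (Rp Rm : ℂ → Mat3) :
    (Fin M₁ ⊕ Fin M₂ ⊕ Fin M₂) ⊕ (Fin M₁ ⊕ Fin M₂ ⊕ Fin M₂) → Mat3 :=
  Sum.elim (fun k => matResidue Rp (d.plusPoint k)) fun k => matResidue Rm (d.minusPoint k)

theorem isClosed_polesPlus (d : SpectralData q₀ M₁ M₂) (j : Fin 3) : IsClosed (d.polesPlus j) :=
  ((Set.finite_range _).subset (d.polesPlus_subset j)).isClosed

theorem isClosed_polesMinus (d : SpectralData q₀ M₁ M₂) (j : Fin 3) : IsClosed (d.polesMinus j) :=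
  ((Set.finite_range _).subset (d.polesMinus_subset j)).isClosed

theorem analyticAt_plus (hR : IsRHSolution σ x t qp qm d Rp Rm) (i j : Fin 3) {z : ℂ}
    (hz : 0 < z.im) (hzp : z ∉ d.polesPlus j) : AnalyticAt ℂ (fun w => Rp w i j) z :=
  (hR.analytic_plus i j).analyticAt
    ((isOpen_DPlus.sdiff (isClosed_polesPlus d j)).mem_nhds ⟨hz, hzp⟩)

theorem analyticAt_minus (hR : IsRHSolution σ x t qp qm d Rp Rm) (i j : Fin 3) {z : ℂ}
    (hz : z.im < 0) (hzp : z ∉ d.polesMinus j) : AnalyticAt ℂ (fun w => Rm w i j) z :=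
  (hR.analytic_minus i j).analyticAt
    ((isOpen_DMinus.sdiff (isClosed_polesMinus d j)).mem_nhds ⟨hz, hzp⟩)

/-- The sum runs over the spectrum in both half-planes and is the same as in `exists_minus`, so that
it drops out of the difference of the two functions on the real line. -/
theorem exists_plus (hR : IsRHSolution σ x t qp qm d Rp Rm) (hq₀ : 0 < q₀) (i j : Fin 3) :
    ∃ F : ℂ → ℂ, HasCauchyDecay DPlus F ∧
      (∀ z ∉ Set.range d.point, F z = Rp z i j - RinfPlus q₀ qp qm i j
        - z⁻¹ * RzeroPlus q₀ i j - ∑ k, (z - d.point k)⁻¹ * residues d Rp Rm k i j) ∧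
      ∀ z, 0 < z.im → z ∉ d.polesPlus j → F z = Rp z i j - RinfPlus q₀ qp qm i j
        - z⁻¹ * RzeroPlus q₀ i j - ∑ k, (z - d.point k)⁻¹ * residues d Rp Rm k i j := by
  obtain ⟨F, hF, h1, h2⟩ := exists_hasCauchyDecay (d.point_injective hq₀) (d.point_im_ne_zero hq₀)
    isOpen_DPlus (fun z hz => ne_of_gt hz) (f := fun z => Rp z i j)
    (a := RinfPlus q₀ qp qm i j) (b := RzeroPlus q₀ i j)
    (r := fun k => residues d Rp Rm k i j) (E := {0, (q₀ : ℂ), -(q₀ : ℂ)})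
    (Set.toFinite _) (by simp)
    ((hR.analytic_plus i j).mono (Set.sdiff_subset_sdiff_right (d.polesPlus_subset j)))
    (by
      rintro (k | k) hk
      · by_cases hkp : d.plusPoint k ∈ d.polesPlus j
        · exact (hR.simple_plus i j _ hkp).tendsto_residue
        · exact (hR.analyticAt_plus i j hk hkp).atMostSimplePole.tendsto_residue
      · exact ((d.minusPoint_im_neg hq₀ k).trans hk).false.elim)
    (fun s hs => tendsto_nhdsWithin_of_continuousOn_sdiff (V := DPlusClosed)
      (isClosed_polesPlus d j)
      (fun z (hz : 0 < z.im) => hz.le) (Set.toFinite _).isClosed (hR.boundary_plus i j)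
      (ofReal_im s).ge
      (fun h => by
        obtain ⟨k, hk⟩ := d.polesPlus_subset j h
        exact ofReal_ne_of_im_ne_zero (d.point_im_ne_zero hq₀ k) s hk.symm) hs)
    (hR.zero_plus i j)
    (fun c hc hc0 => hR.branch_plus i j c (hc.resolve_left hc0)) (hR.infty_plus i j)
  exact ⟨F, hF, h1, fun z hz hzp => h2 z hz (hR.analyticAt_plus i j hz hzp).continuousAt⟩

theorem exists_minus (hR : IsRHSolution σ x t qp qm d Rp Rm) (hq₀ : 0 < q₀) (i j : Fin 3) :
    ∃ F : ℂ → ℂ, HasCauchyDecay DMinus F ∧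
      (∀ z ∉ Set.range d.point, F z = Rm z i j - RinfMinus q₀ qp qm i j
        - z⁻¹ * RzeroMinus qm i j - ∑ k, (z - d.point k)⁻¹ * residues d Rp Rm k i j) ∧
      ∀ z, z.im < 0 → z ∉ d.polesMinus j → F z = Rm z i j - RinfMinus q₀ qp qm i j
        - z⁻¹ * RzeroMinus qm i j - ∑ k, (z - d.point k)⁻¹ * residues d Rp Rm k i j := by
  obtain ⟨F, hF, h1, h2⟩ := exists_hasCauchyDecay (d.point_injective hq₀) (d.point_im_ne_zero hq₀)
    isOpen_DMinus (fun z hz => ne_of_lt hz) (f := fun z => Rm z i j)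
    (a := RinfMinus q₀ qp qm i j) (b := RzeroMinus qm i j)
    (r := fun k => residues d Rp Rm k i j) (E := {0, (q₀ : ℂ), -(q₀ : ℂ)})
    (Set.toFinite _) (by simp)
    ((hR.analytic_minus i j).mono (Set.sdiff_subset_sdiff_right (d.polesMinus_subset j)))
    (by
      rintro (k | k) hk
      · exact ((d.plusPoint_im_pos hq₀ k).trans hk).false.elim
      · by_cases hkp : d.minusPoint k ∈ d.polesMinus j
        · exact (hR.simple_minus i j _ hkp).tendsto_residue
        · exact (hR.analyticAt_minus i j hk hkp).atMostSimplePole.tendsto_residue)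
    (fun s hs => tendsto_nhdsWithin_of_continuousOn_sdiff (V := DMinusClosed)
      (isClosed_polesMinus d j)
      (fun z (hz : z.im < 0) => hz.le) (Set.toFinite _).isClosed (hR.boundary_minus i j)
      (ofReal_im s).le
      (fun h => by
        obtain ⟨k, hk⟩ := d.polesMinus_subset j h
        exact ofReal_ne_of_im_ne_zero (d.point_im_ne_zero hq₀ k) s hk.symm) hs)
    (hR.zero_minus i j)
    (fun c hc hc0 => hR.branch_minus i j c (hc.resolve_left hc0)) (hR.infty_minus i j)
  exact ⟨F, hF, h1, fun z hz hzp => h2 z hz (hR.analyticAt_minus i j hz hzp).continuousAt⟩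

theorem expDelta_mul_expNegDelta (z : ℂ) :
    expDelta q₀ σ x t z * expNegDelta q₀ σ x t z = 1 := by
  rw [expDelta, expNegDelta, Matrix.diagonal_mul_diagonal, ← Matrix.diagonal_one]
  congr 1
  funext j
  rw [← exp_add, add_neg_cancel, exp_zero]

/-- The density is the jump of the solution with its leading terms removed. -/
theorem density_eq (hR : IsRHSolution σ x t qp qm d Rp Rm) {s : ℝ} (h0 : s ≠ 0) (h1 : s ≠ q₀)
    (h2 : s ≠ -q₀) :
    density σ x t qp qm d Rm s = (RinfMinus q₀ qp qm - RinfPlus q₀ qp qm)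
      + (s : ℂ)⁻¹ • (RzeroMinus qm - RzeroPlus q₀) + (Rp s - Rm s) := by
  -- With `L = K - 1`, the `K` part is `Rp` by the jump condition, and in the identity part the
  -- exponentials cancel.
  rw [density, SpectralData.L, Matrix.mul_sub, Matrix.sub_mul, ← hR.jump s h0 h1 h2, mul_one,
    mul_assoc (Rm s), expDelta_mul_expNegDelta, mul_one]

/-- The entries of a solution in terms of the Cauchy integral of the density. -/
theorem entry_formula (hR : IsRHSolution σ x t qp qm d Rp Rm) (hq₀ : 0 < q₀) (i j : Fin 3) {z : ℂ}
    (hz : z.im ≠ 0) :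
    (Integrable fun s : ℝ => density σ x t qp qm d Rm s i j / ((s : ℂ) - z)) ∧
    (0 < z.im → z ∉ d.polesPlus j → Rp z i j = RinfPlus q₀ qp qm i j + z⁻¹ * RzeroPlus q₀ i j
      + cauchyIntegral (density σ x t qp qm d Rm) z i j
      + ∑ k, (z - d.point k)⁻¹ * residues d Rp Rm k i j) ∧
    (z.im < 0 → z ∉ d.polesMinus j → Rm z i j = RinfMinus q₀ qp qm i j + z⁻¹ * RzeroMinus qm i j
      + cauchyIntegral (density σ x t qp qm d Rm) z i j
      + ∑ k, (z - d.point k)⁻¹ * residues d Rp Rm k i j) := by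
  obtain ⟨F, hF, hF1, hF2⟩ := hR.exists_plus hq₀ i j
  obtain ⟨G, hG, hG1, hG2⟩ := hR.exists_minus hq₀ i j
  obtain ⟨hint, hval⟩ := hF.plemelj hG hz
  -- The points `0, ±q₀`, where the jump condition says nothing, form a null set.
  have hae : (fun s : ℝ => (F s - G s) / (s - z)) =ᵐ[volume]
      fun s : ℝ => density σ x t qp qm d Rm s i j / ((s : ℂ) - z) := by
    have hnull : volume ({0, q₀, -q₀} : Set ℝ) = 0 := (Set.toFinite _).measure_zero _
    filter_upwards [compl_mem_ae_iff.2 hnull] with s hs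
    simp only [Set.mem_compl_iff, Set.mem_insert_iff, Set.mem_singleton_iff, not_or] at hs
    have hsP : (s : ℂ) ∉ Set.range d.point := by
      rintro ⟨k, hk⟩
      exact ofReal_ne_of_im_ne_zero (d.point_im_ne_zero hq₀ k) s hk.symm
    rw [hR.density_eq hs.1 hs.2.1 hs.2.2, hF1 _ hsP, hG1 _ hsP]
    congr 1
    simp only [Matrix.add_apply, Matrix.sub_apply, Matrix.smul_apply, smul_eq_mul]
    ring
  have hC : cauchyIntegral (density σ x t qp qm d Rm) z i j = sectional (F z) (G z) z := by
    rw [← hval, integral_congr_ae hae]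
    rfl
  refine ⟨hint.congr hae, fun h hp => ?_, fun h hp => ?_⟩
  · rw [hC, sectional, if_pos h, hF2 z h hp]
    ring
  · rw [hC, sectional, if_neg h.not_gt, hG2 z h hp]
    ring

/-! ### Residues column by column -/

theorem sum_residues (Rp Rm : ℂ → Mat3) (z : ℂ) (i j : Fin 3) :
    ∑ k, (z - d.point k)⁻¹ * residues d Rp Rm k i j =
      ∑ m, ((z - d.z m)⁻¹ * matResidue Rp (d.z m) i j
        + (z - d.zc m)⁻¹ * matResidue Rm (d.zc m) i j)
      + ∑ m, ((z - d.θ m)⁻¹ * matResidue Rp (d.θ m) i j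
        + (z - d.θc m)⁻¹ * matResidue Rm (d.θc m) i j)
      + ∑ m, ((z - d.θic m)⁻¹ * matResidue Rp (d.θic m) i j
        + (z - d.θi m)⁻¹ * matResidue Rm (d.θi m) i j) := by
  simp only [Fintype.sum_sum_type, SpectralData.point, SpectralData.plusPoint,
    SpectralData.minusPoint, residues, Sum.elim_inl, Sum.elim_inr, Finset.sum_add_distrib]
  ring

/-- Each matrix in the residue conditions has a single possibly nonzero entry: its column is the
column of the residue, its row selects the column of `Rp` or `Rm` that is evaluated. Columns with a
pole at the point meet only zero entries, so their values there do not matter. The next two lemmas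
rest on the same fact. -/
theorem sum_residues_col_zero (hR : IsRHSolution σ x t qp qm d Rp Rm) (z : ℂ) (i : Fin 3) :
    ∑ k, (z - d.point k)⁻¹ * residues d Rp Rm k i 0 =
      ∑ m, I * d.C σ x t m * rho q₀ (d.z m) / (z - d.z m) * Rp (d.z m) i 2
        - ∑ m, d.F σ x t m / (z - d.θ m) * Rp (d.θ m) i 1 := by
  rw [sum_residues, sub_eq_add_neg, ← Finset.sum_neg_distrib]
  simp only [hR.res_z, hR.res_zc, hR.res_θ, hR.res_θc, hR.res_θi, hR.res_θic]
  simp [Matrix.mul_apply, Fin.sum_univ_three, div_eq_mul_inv]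
  congr 1 <;> [skip; congr 1] <;> exact Finset.sum_congr rfl fun m _ => by ring

theorem sum_residues_col_one (hR : IsRHSolution σ x t qp qm d Rp Rm) (z : ℂ) (i : Fin 3) :
    ∑ k, (z - d.point k)⁻¹ * residues d Rp Rm k i 1 =
      ∑ m, I * d.Fbar σ x t m * rho q₀ (d.θc m) / (z - d.θc m) * Rm (d.θc m) i 0
        - ∑ m, I * d.Fhat σ x t m * rho q₀ (d.θic m) / (z - d.θic m) * Rp (d.θic m) i 2 := by
  rw [sum_residues, sub_eq_add_neg, ← Finset.sum_neg_distrib]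
  simp only [hR.res_z, hR.res_zc, hR.res_θ, hR.res_θc, hR.res_θi, hR.res_θic]
  simp [Matrix.mul_apply, Fin.sum_univ_three, div_eq_mul_inv]
  congr 1 <;> [skip; congr 1] <;> exact Finset.sum_congr rfl fun m _ => by ring

theorem sum_residues_col_two (hR : IsRHSolution σ x t qp qm d Rp Rm) (z : ℂ) (i : Fin 3) :
    ∑ k, (z - d.point k)⁻¹ * residues d Rp Rm k i 2 =
      ∑ m, I * d.Cbar σ x t m * rho q₀ (d.zc m) / (z - d.zc m) * Rm (d.zc m) i 0
        + ∑ m, d.Fcheck σ x t m / (z - d.θi m) * Rm (d.θi m) i 1 := by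
  rw [sum_residues]
  simp only [hR.res_z, hR.res_zc, hR.res_θ, hR.res_θc, hR.res_θi, hR.res_θic]
  simp [Matrix.mul_apply, Fin.sum_univ_three, div_eq_mul_inv]
  congr 1 <;> exact Finset.sum_congr rfl fun m _ => by ring

end IsRHSolution

end HirotaRH

end

/-! ### The solution formula -/

open HirotaRH in
theorem theorem4 (q₀ σ x t : ℝ) (hq₀ : 0 < q₀) (qp qm : Vec2)
    (hqp : ‖qp‖ = q₀) (hqm : ‖qm‖ = q₀) (hnonorth : inner ℂ qp qm ≠ (0 : ℂ))
    (M₁ M₂ : ℕ) (d : SpectralData q₀ M₁ M₂) (Rp Rm : ℂ → Mat3)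
    (hR : IsRHSolution σ x t qp qm d Rp Rm) :
    (∀ z : ℂ, z.im ≠ 0 → ∀ i j,
      Integrable fun s : ℝ => density σ x t qp qm d Rm s i j / ((s : ℂ) - z)) ∧
    (∀ z : ℂ, z.im ≠ 0 → z ∉ d.spectrum →
      sectional (Rp z) (Rm z) z =
        sectional (RinfPlus q₀ qp qm) (RinfMinus q₀ qp qm) z
          + z⁻¹ • sectional (RzeroPlus q₀) (RzeroMinus qm) z
          + cauchyIntegral (density σ x t qp qm d Rm) z
          + ∑ m, ((z - d.z m)⁻¹ • matResidue Rp (d.z m)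
              + (z - d.zc m)⁻¹ • matResidue Rm (d.zc m))
          + ∑ m, ((z - d.θ m)⁻¹ • matResidue Rp (d.θ m)
              + (z - d.θc m)⁻¹ • matResidue Rm (d.θc m))
          + ∑ m, ((z - d.θic m)⁻¹ • matResidue Rp (d.θic m)
              + (z - d.θi m)⁻¹ • matResidue Rm (d.θi m))) ∧
    (∀ z : ℂ, z.im < 0 →
      (Rm z).col 0 = ![1, qm 0 / z, qm 1 / z]
        + (cauchyIntegral (density σ x t qp qm d Rm) z).col 0
        + ∑ m, (I * d.C σ x t m * rho q₀ (d.z m) / (z - d.z m)) • (Rp (d.z m)).col 2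
        - ∑ m, (d.F σ x t m / (z - d.θ m)) • (Rp (d.θ m)).col 1) ∧
    (∀ z : ℂ, 0 < z.im →
      (Rp z).col 2 = ![-I * q₀ / z, -I * qm 0 / q₀, -I * qm 1 / q₀]
        + (cauchyIntegral (density σ x t qp qm d Rm) z).col 2
        + ∑ m, (I * d.Cbar σ x t m * rho q₀ (d.zc m) / (z - d.zc m)) • (Rm (d.zc m)).col 0
        + ∑ m, (d.Fcheck σ x t m / (z - d.θi m)) • (Rm (d.θi m)).col 1) ∧
    (∀ n, (Rp (d.θ n)).col 1 =
        ![0, q₀ * perp qp 0 / inner ℂ qp qm, q₀ * perp qp 1 / inner ℂ qp qm]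
        + (cauchyIntegral (density σ x t qp qm d Rm) (d.θ n)).col 1
        + ∑ m, (I * d.Fbar σ x t m * rho q₀ (d.θc m) / (d.θ n - d.θc m)) • (Rm (d.θc m)).col 0
        - ∑ m, (I * d.Fhat σ x t m * rho q₀ (d.θic m) / (d.θ n - d.θic m))
            • (Rp (d.θic m)).col 2) ∧
    (∀ n, (Rm (d.θi n)).col 1 =
        ![0, perp qm 0 / q₀, perp qm 1 / q₀]
        + (cauchyIntegral (density σ x t qp qm d Rm) (d.θi n)).col 1
        + ∑ m, (I * d.Fbar σ x t m * rho q₀ (d.θc m) / (d.θi n - d.θc m)) • (Rm (d.θc m)).col 0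
        - ∑ m, (I * d.Fhat σ x t m * rho q₀ (d.θic m) / (d.θi n - d.θic m))
            • (Rp (d.θic m)).col 2) := by
  refine ⟨fun z hz i j => (hR.entry_formula hq₀ i j hz).1, fun z hz hsp => ?_, fun z hz => ?_,
    fun z hz => ?_, fun n => ?_, fun n => ?_⟩
  · have hrange : z ∉ Set.range d.point := by
      rintro ⟨k, rfl⟩
      exact hsp (d.point_mem_spectrum k)
    ext i j
    obtain ⟨-, h1, h2⟩ := hR.entry_formula hq₀ i j hz
    simp only [Matrix.add_apply, Matrix.smul_apply, Matrix.sum_apply, smul_eq_mul]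
    rcases hz.lt_or_gt with h | h
    · simp only [sectional, if_neg h.not_gt]
      rw [h2 h fun hp => hrange (d.polesMinus_subset j hp), IsRHSolution.sum_residues]
      ring
    · simp only [sectional, if_pos h]
      rw [h1 h fun hp => hrange (d.polesPlus_subset j hp), IsRHSolution.sum_residues]
      ring
  · funext i
    -- The first column of `Rm` has no poles, so no spectral point below the line has to be
    -- excluded; the same holds for the third column of `Rp` above it.
    have h := (hR.entry_formula hq₀ i 0 hz.ne).2.2 hz (by simp [SpectralData.polesMinus])
    rw [hR.sum_residues_col_zero] at h
    simp only [Matrix.col_apply, Pi.add_apply, Pi.sub_apply, Finset.sum_apply, Pi.smul_apply,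
      smul_eq_mul, h]
    fin_cases i <;> simp [RinfMinus, RzeroMinus, div_eq_inv_mul] <;> ring
  · funext i
    have h := (hR.entry_formula hq₀ i 2 hz.ne').2.1 hz (by simp [SpectralData.polesPlus])
    rw [hR.sum_residues_col_two] at h
    simp only [Matrix.col_apply, Pi.add_apply, Finset.sum_apply, Pi.smul_apply,
      smul_eq_mul, h]
    fin_cases i <;> simp [RinfPlus, RzeroPlus, div_eq_inv_mul] <;> ring
  · funext i
    have hn := d.θ_im_pos n
    -- The second column of `Rp` has its poles outside the circle of radius `q₀`, while `θ_n` lies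
    -- inside.
    have h := (hR.entry_formula hq₀ i 1 hn.ne').2.1 hn (by
      rintro ⟨m, hm⟩
      have h1 := d.lt_norm_θi hq₀ m
      rw [← d.norm_θic, hm] at h1
      exact (h1.trans (d.θ_norm_lt n)).false)
    rw [hR.sum_residues_col_one] at h
    simp only [Matrix.col_apply, Pi.add_apply, Pi.sub_apply, Finset.sum_apply, Pi.smul_apply,
      smul_eq_mul, h]
    fin_cases i <;> simp [RinfPlus, RzeroPlus] <;> ring
  · funext i
    have hn := d.θi_im_neg hq₀ n
    -- Here the roles are reversed: the poles `θ_m*` of the second column of `Rm` lie inside the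
    -- circle and `q₀²/θ_n` outside.
    have h := (hR.entry_formula hq₀ i 1 hn.ne).2.2 hn (by
      rintro ⟨m, hm⟩
      have h1 := d.θ_norm_lt m
      have h2 : ‖d.θc m‖ = ‖d.θ m‖ := RCLike.norm_conj _
      rw [← h2, hm] at h1
      exact (h1.trans (d.lt_norm_θi hq₀ n)).false)
    rw [hR.sum_residues_col_one] at h
    simp only [Matrix.col_apply, Pi.add_apply, Pi.sub_apply, Finset.sum_apply, Pi.smul_apply,
      smul_eq_mul, h]
    fin_cases i <;> simp [RinfMinus, RzeroMinus] <;> ring
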